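/- **Corollary (Lie symmetry algebra of the flat model (i)).** On $\mathbb R^5$ with coordinates $(x,y,z,p,r)$ (where $p=z_x$, $r=z_{xx}$), associate to the PDE system $$z_y=\tfrac14 (z_x)^2,\qquad z_{xxx}=0$$ the $1$-forms $$\omega^1=dz-p\,dx-\tfrac14p^2\,dy,\quad \omega^2=dp-r\,dx-\tfrac12pr\,dy,\quad \omega^3=dr-\tfrac12r^2\,dy,\quad \omega^4=dx,\quad \omega^5=dy .$$ Let $U\subseteq\mathbb R^5$ be a nonempty connected open set. An infinitesimal point symmetry of the system on $U$ is a real $C^\infty$ vector field $X$ on $U$ such that $$\mathcal L_X\omega^1\wedge\omega^1=0,\qquad \mathcal L_X\omega^i\wedge\omega^1\wedge\omega^2\wedge\omega^3=0\ (i=2,3),\qquad \mathcal L_X\omega^i\wedge\omega^1\wedge\omega^4\wedge\omega^5=0\ (i=4,5).$$ Then the infinitesimal point symmetries on $U$ form a real Lie algebra under the bracket of vector fields. It is simple, isomorphic to $\mathfrak{so}(3,2)$, and has as a basis the (restrictions to $U$ of the) ten vector fields $$\begin{aligned} X_1&=xy\,\partial_x+y^2\,\partial_y-x^2\,\partial_z-(py+2x)\,\partial_p-(2ry+2)\,\partial_r,\\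 X_2&=-(x^2-yz)\,\partial_x-2xy\,\partial_y-2xz\,\partial_z-\big(\tfrac12p^2y+2z\big)\,\partial_p-(pry-2rx+2p)\,\partial_r,\\ X_3&=y\,\partial_x-2x\,\partial_z-2\,\partial_p,\\ X_4&=xz\,\partial_x-x^2\,\partial_y+z^2\,\partial_z-\big(\tfrac12p^2x-pz\big)\,\partial_p+\big(\tfrac12p^2-prx\big)\,\partial_r,\\ X_5&=z\,\partial_x-2x\,\partial_y-\tfrac12p^2\,\partial_p-pr\,\partial_r,\\ X_6&=x\,\partial_x+2z\,\partial_z+p\,\partial_p,\\ X_7&=\partial_x,\\ X_8&=y\,\partial_y-z\,\partial_z-p\,\partial_p-r\,\partial_r,\\ X_9&=\partial_y,\\ X_{10}&=\partial_z . \end{aligned}$$ Their commutators $[X_i,X_j]$ (row $i$, column $j$) are given by the table $$\begin{array}{l|cccccccccc} & X_1&X_2&X_3&X_4&X_5&X_6&X_7&X_8&X_9&X_{10}\\ \hline X_1&0&0&0&0&-X_2&0&-X_3&-X_1&-X_6-2X_8&0\\ X_2&*&0&2X_1&0&2X_4&-X_2&2X_6+2X_8&0&-X_5&-X_3\\ X_3&*&*&0&X_2&-2X_8&X_3&2X_{10}&-X_3&-X_7&0\\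 X_4&*&*&*&0&0&-2X_4&-X_5&X_4&0&-X_6\\ X_5&*&*&*&*&0&-X_5&2X_9&X_5&0&-X_7\\ X_6&*&*&*&*&*&0&-X_7&0&0&-2X_{10}\\ X_7&*&*&*&*&*&*&0&0&0&0\\ X_8&*&*&*&*&*&*&*&0&-X_9&X_{10}\\ X_9&*&*&*&*&*&*&*&*&0&0\\ X_{10}&*&*&*&*&*&*&*&*&*&0 \end{array}$$ where the entries $*$ are determined by antisymmetry. -/

import Mathlib

open scoped ContDiff
open TopologicalSpace (Opens)

noncomputable section

namespace ParaCR

/-- The space of second jets, with coordinates `(x, y, z, p, r)` at the indices `0, 1, 2, 3, 4`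
(`p = z_x`, `r = z_xx`). -/
abbrev Jet : Type := Fin 5 → ℝ

/-! ### The Lie algebra of smooth vector fields on an open set -/

/-- Smooth vector fields on the open set `U`. Such a field is represented by the function that
equals it on `U` and is zero outside `U`, so that two fields are equal iff they agree on `U`. -/
def smoothFields (U : Opens Jet) : Submodule ℝ (Jet → Jet) where
  carrier := {X | ContDiffOn ℝ ∞ X U ∧ ∀ q ∉ U, X q = 0}
  add_mem' := by
    rintro X Y ⟨hX, hX0⟩ ⟨hY, hY0⟩
    exact ⟨hX.add hY, fun q hq => by simp [hX0 q hq, hY0 q hq]⟩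
  zero_mem' := ⟨contDiffOn_const, fun _ _ => rfl⟩
  smul_mem' := by
    rintro c X ⟨hX, hX0⟩
    exact ⟨hX.const_smul c, fun q hq => by simp [hX0 q hq]⟩

variable {U : Opens Jet}

theorem smoothFields.contDiffAt (X : smoothFields U) {q : Jet} (hq : q ∈ U) :
    ContDiffAt ℝ ∞ (X : Jet → Jet) q :=
  X.2.1.contDiffAt (U.isOpen.mem_nhds hq)

theorem smoothFields.differentiableAt (X : smoothFields U) {q : Jet} (hq : q ∈ U) :
    DifferentiableAt ℝ (X : Jet → Jet) q :=
  (smoothFields.contDiffAt X hq).differentiableAt (by simp)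

theorem smoothFields.ext {X Y : smoothFields U}
    (h : ∀ q ∈ U, (X : Jet → Jet) q = (Y : Jet → Jet) q) : X = Y := by
  apply Subtype.ext
  funext q
  by_cases hq : q ∈ U
  · exact h q hq
  · rw [X.2.2 q hq, Y.2.2 q hq]

open Classical in
/-- The Lie bracket of vector fields on `U`: `[X, Y] = DY · X - DX · Y` on `U`. -/
instance : Bracket (smoothFields U) (smoothFields U) where
  bracket X Y :=
    ⟨(U : Set Jet).indicator (VectorField.lieBracket ℝ (X : Jet → Jet) (Y : Jet → Jet)), by
      constructor
      · intro q hq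
        have h : ContDiffAt ℝ ∞ (VectorField.lieBracket ℝ (X : Jet → Jet) (Y : Jet → Jet)) q :=
          ContDiffAt.lieBracket_vectorField (n := ∞) (smoothFields.contDiffAt X hq)
            (smoothFields.contDiffAt Y hq) le_rfl
        refine (h.congr_of_eventuallyEq ?_).contDiffWithinAt
        filter_upwards [U.isOpen.mem_nhds hq] with q' hq'
        exact Set.indicator_of_mem hq' _
      · intro q hq
        exact Set.indicator_of_notMem hq _⟩

theorem smoothFields.bracket_apply (X Y : smoothFields U) {q : Jet} (hq : q ∈ U) :
    (⁅X, Y⁆ : smoothFields U).1 q =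
      VectorField.lieBracket ℝ (X : Jet → Jet) (Y : Jet → Jet) q :=
  Set.indicator_of_mem hq _

theorem smoothFields.bracket_eventuallyEq (X Y : smoothFields U) {q : Jet} (hq : q ∈ U) :
    (⁅X, Y⁆ : smoothFields U).1 =ᶠ[nhds q]
      VectorField.lieBracket ℝ (X : Jet → Jet) (Y : Jet → Jet) := by
  filter_upwards [U.isOpen.mem_nhds hq] with q' hq'
  exact smoothFields.bracket_apply X Y hq'

instance : LieRing (smoothFields U) where
  add_lie X Y Z := smoothFields.ext fun q hq => by
    rw [smoothFields.bracket_apply _ _ hq]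
    simp only [Submodule.coe_add, Pi.add_apply]
    rw [smoothFields.bracket_apply _ _ hq, smoothFields.bracket_apply _ _ hq]
    exact VectorField.lieBracket_add_left (smoothFields.differentiableAt X hq)
      (smoothFields.differentiableAt Y hq)
  lie_add X Y Z := smoothFields.ext fun q hq => by
    rw [smoothFields.bracket_apply _ _ hq]
    simp only [Submodule.coe_add, Pi.add_apply]
    rw [smoothFields.bracket_apply _ _ hq, smoothFields.bracket_apply _ _ hq]
    exact VectorField.lieBracket_add_right (smoothFields.differentiableAt Y hq)
      (smoothFields.differentiableAt Z hq)
  lie_self X := smoothFields.ext fun q hq => by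
    rw [smoothFields.bracket_apply _ _ hq]
    simp
  leibniz_lie X Y Z := smoothFields.ext fun q hq => by
    simp only [Submodule.coe_add, Pi.add_apply]
    rw [smoothFields.bracket_apply _ _ hq, smoothFields.bracket_apply _ _ hq,
      smoothFields.bracket_apply _ _ hq,
      Filter.EventuallyEq.lieBracket_vectorField_eq Filter.EventuallyEq.rfl
        (smoothFields.bracket_eventuallyEq Y Z hq),
      Filter.EventuallyEq.lieBracket_vectorField_eq
        (smoothFields.bracket_eventuallyEq X Y hq) Filter.EventuallyEq.rfl,
      Filter.EventuallyEq.lieBracket_vectorField_eq Filter.EventuallyEq.rfl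
        (smoothFields.bracket_eventuallyEq X Z hq)]
    exact VectorField.leibniz_identity_lieBracket (n := ∞)
      (by simpa using (mod_cast le_top : ((2 : ℕ∞) : ℕ∞ω) ≤ ∞))
      (smoothFields.contDiffAt X hq) (smoothFields.contDiffAt Y hq)
      (smoothFields.contDiffAt Z hq)

instance : LieAlgebra ℝ (smoothFields U) where
  lie_smul c X Y := smoothFields.ext fun q hq => by
    rw [smoothFields.bracket_apply _ _ hq]
    simp only [Submodule.coe_smul, Pi.smul_apply]
    rw [smoothFields.bracket_apply _ _ hq]
    exact VectorField.lieBracket_const_smul_right (smoothFields.differentiableAt Y hq)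

/-! ### One-forms, wedge products and Lie derivatives -/

/-- A differential one-form on the jet space. -/
abbrev OneForm : Type := Jet → (Jet →L[ℝ] ℝ)

/-- The wedge product `α₀ ∧ ⋯ ∧ αₖ₋₁` of covectors, `(v₀, …, vₖ₋₁) ↦ det (αᵢ(vⱼ))`. -/
def wedge {k : ℕ} (α : Fin k → (Jet →L[ℝ] ℝ)) : Jet [⋀^Fin k]→ₗ[ℝ] ℝ :=
  Matrix.detRowAlternating.compLinearMap (LinearMap.pi fun i => (α i : Jet →ₗ[ℝ] ℝ))

theorem wedge_apply {k : ℕ} (α : Fin k → (Jet →L[ℝ] ℝ)) (v : Fin k → Jet) :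
    wedge α v = Matrix.det (Matrix.of fun i j => α i (v j)) := by
  rw [← Matrix.det_transpose]
  rfl

/-- The Lie derivative `L_X α` of a one-form along a vector field, in coordinates
`(L_X α)_i = ∑ⱼ (Xʲ ∂ⱼαᵢ + αⱼ ∂ᵢXʲ)`. -/
def lieDerivative (X : Jet → Jet) (α : OneForm) : OneForm := fun q =>
  fderiv ℝ α q (X q) + (α q).comp (fderiv ℝ X q)

/-! ### The coframe of a system `z_y = F`, `z_xxx = H` and its infinitesimal point symmetries -/

/-- The partial derivative in the `i`-th coordinate. -/
def pd (i : Fin 5) (f : Jet → ℝ) : Jet → ℝ := fun q => fderiv ℝ f q (Pi.single i 1)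

/-- The total derivative `D = ∂_x + p ∂_z + r ∂_p + H ∂_r`. -/
def totalD (H : Jet → ℝ) (f : Jet → ℝ) : Jet → ℝ := fun q =>
  pd 0 f q + q 3 * pd 2 f q + q 4 * pd 3 f q + H q * pd 4 f q

/-- The coordinate covector `dx, dy, dz, dp, dr` for `i = 0, 1, 2, 3, 4`. -/
def dcoord (i : Fin 5) : Jet →L[ℝ] ℝ := ContinuousLinearMap.proj i

/-- `ω¹ = dz - p dx - F dy`. -/
def omega1 (F : Jet → ℝ) : OneForm := fun q => dcoord 2 - q 3 • dcoord 0 - F q • dcoord 1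

/-- `ω² = dp - r dx - DF dy`. -/
def omega2 (F H : Jet → ℝ) : OneForm := fun q =>
  dcoord 3 - q 4 • dcoord 0 - totalD H F q • dcoord 1

/-- `ω³ = dr - H dx - D²F dy`. -/
def omega3 (F H : Jet → ℝ) : OneForm := fun q =>
  dcoord 4 - H q • dcoord 0 - totalD H (totalD H F) q • dcoord 1

/-- `ω⁴ = dx`. -/
def omega4 : OneForm := fun _ => dcoord 0

/-- `ω⁵ = dy`. -/
def omega5 : OneForm := fun _ => dcoord 1

/-- A vector field `X` on `U` is an infinitesimal point symmetry of the system
`z_y = F(x,y,z,z_x,z_xx)`, `z_xxx = H(x,y,z,z_x,z_xx)`: its flow preserves the para-CR structure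
given by the coframe `(ω¹, …, ω⁵)`, that is, `L_X ω¹` is a multiple of `ω¹`, `L_X ω²` and `L_X ω³`
are combinations of `ω¹, ω², ω³`, and `L_X ω⁴` and `L_X ω⁵` are combinations of `ω¹, ω⁴, ω⁵`. -/
def IsInfinitesimalPointSymmetry (F H : Jet → ℝ) (U : Opens Jet) (X : Jet → Jet) : Prop :=
  ∀ q ∈ U,
    wedge ![lieDerivative X (omega1 F) q, omega1 F q] = 0 ∧
    wedge ![lieDerivative X (omega2 F H) q, omega1 F q, omega2 F H q, omega3 F H q] = 0 ∧
    wedge ![lieDerivative X (omega3 F H) q, omega1 F q, omega2 F H q, omega3 F H q] = 0 ∧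
    wedge ![lieDerivative X omega4 q, omega1 F q, omega4 q, omega5 q] = 0 ∧
    wedge ![lieDerivative X omega5 q, omega1 F q, omega4 q, omega5 q] = 0

/-! ### The flat model `z_y = (1/4) z_x²`, `z_xxx = 0` -/

/-- The function `F = p² / 4`. -/
def flatF : Jet → ℝ := fun q => (1 / 4) * q 3 ^ 2

/-- The function `H = 0`. -/
def flatH : Jet → ℝ := fun _ => 0

/-- The polynomial vector fields `X₁, …, X₁₀` (at the indices `0, …, 9`) at the point
`(x, y, z, p, r)`, by their components along `∂_x, ∂_y, ∂_z, ∂_p, ∂_r`. -/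
def flatFieldAt (x y z p r : ℝ) : Fin 10 → Jet :=
  ![![x * y, y ^ 2, -x ^ 2, -(p * y + 2 * x), -(2 * r * y + 2)],
    ![-(x ^ 2 - y * z), -2 * x * y, -2 * x * z, -((1 / 2) * p ^ 2 * y + 2 * z),
      -(p * r * y - 2 * r * x + 2 * p)],
    ![y, 0, -2 * x, -2, 0],
    ![x * z, -x ^ 2, z ^ 2, -((1 / 2) * p ^ 2 * x - p * z), (1 / 2) * p ^ 2 - p * r * x],
    ![z, -2 * x, 0, -(1 / 2) * p ^ 2, -p * r],
    ![x, 0, 2 * z, p, 0],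
    ![1, 0, 0, 0, 0],
    ![0, y, -z, -p, -r],
    ![0, 1, 0, 0, 0],
    ![0, 0, 1, 0, 0]]

/-- The vector fields `X₁, …, X₁₀` on the jet space. -/
def flatField (i : Fin 10) : Jet → Jet := fun q =>
  flatFieldAt (q 0) (q 1) (q 2) (q 3) (q 4) i

/-- The commutator table: the entry in row `i` and column `j`, for `i ≤ j`, is the bracket of the
`i`-th and the `j`-th generator. The entries below the diagonal are determined by antisymmetry and
are filled with `0` here. -/
def flatTable {V : Type*} [AddCommGroup V] [Module ℝ V] (X₁ X₂ X₃ X₄ X₅ X₆ X₇ X₈ X₉ X₁₀ : V) :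
    Fin 10 → Fin 10 → V :=
  ![![0, 0, 0, 0, -X₂, 0, -X₃, -X₁, -X₆ - (2 : ℝ) • X₈, 0],
    ![0, 0, (2 : ℝ) • X₁, 0, (2 : ℝ) • X₄, -X₂, (2 : ℝ) • X₆ + (2 : ℝ) • X₈, 0, -X₅, -X₃],
    ![0, 0, 0, X₂, -(2 : ℝ) • X₈, X₃, (2 : ℝ) • X₁₀, -X₃, -X₇, 0],
    ![0, 0, 0, 0, 0, -(2 : ℝ) • X₄, -X₅, X₄, 0, -X₆],
    ![0, 0, 0, 0, 0, -X₅, (2 : ℝ) • X₉, X₅, 0, -X₇],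
    ![0, 0, 0, 0, 0, 0, -X₇, 0, 0, -(2 : ℝ) • X₁₀],
    ![0, 0, 0, 0, 0, 0, 0, 0, 0, 0],
    ![0, 0, 0, 0, 0, 0, 0, 0, -X₉, X₁₀],
    ![0, 0, 0, 0, 0, 0, 0, 0, 0, 0],
    ![0, 0, 0, 0, 0, 0, 0, 0, 0, 0]]

end ParaCR

end

open scoped ContDiff
open TopologicalSpace (Opens)

noncomputable section

namespace ParaCR

/-! The symmetries are the conformal Killing fields of the metric g = dx² + dy dz, of signature
(2,1), prolonged to the variables p and r; the conformal algebra of this metric is so(3,2). The link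
is the null vector v = (-p/2, 1, -p²/4) in (x,y,z)-space: ω¹ = 2g(v, ·). The last two symmetry
conditions and the first make the components A, B, C along ∂_x, ∂_y, ∂_z independent of p and r, and
the first then says (L_X g)(v,v) = 0. This is a polynomial of degree 4 in p whose coefficients are
the conformal Killing equations (`IsInfinitesimalPointSymmetry.isFlatKilling`). That system closes
after differentiation: on a connected open set a solution is determined by ten derivatives at one
point (`IsFlatKilling.eq_zero`), and A, B, C determine the p- and r-components. The ten given fields
are symmetries, so a dimension count shows that they span all of them (`mem_flatSymmetries_iff`).
The algebraic claims are settled on coefficient vectors in ℝ¹⁰ with the bracket `flatBracket` and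
transported along linear isomorphisms. Its only ideals are 0 and the whole space
(`eq_bot_or_eq_top_of_flatBracket_mem`); this gives simplicity, and also the injectivity of every
nonzero bracket-preserving map, both to matrices and to vector fields. -/

/-! ### The structure constants and the absence of proper ideals -/

/-- The bracket on coefficient vectors determined by the commutator table. -/
def flatBracket (c d : Fin 10 → ℝ) : Fin 10 → ℝ :=
  let w : Fin 10 → Fin 10 → ℝ := fun i j => c i * d j - c j * d i
  ![2 * w 1 2 - w 0 7,
    -w 0 4 - w 1 5 + w 2 3,
    -w 0 6 - w 1 9 + w 2 5 - w 2 7,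
    2 * w 1 4 - 2 * w 3 5 + w 3 7,
    -w 1 8 - w 3 6 - w 4 5 + w 4 7,
    -w 0 8 + 2 * w 1 6 - w 3 9,
    -w 2 8 - w 4 9 - w 5 6,
    -2 * w 0 8 + 2 * w 1 6 - 2 * w 2 4,
    2 * w 4 6 - w 7 8,
    2 * w 2 6 - 2 * w 5 9 + w 7 9]

/-- The coefficient vector of the `i`-th generator. -/
abbrev gen (i : Fin 10) : Fin 10 → ℝ := Pi.single i 1

theorem gen_eq : (gen : Fin 10 → Fin 10 → ℝ) =
    ![![1, 0, 0, 0, 0, 0, 0, 0, 0, 0], ![0, 1, 0, 0, 0, 0, 0, 0, 0, 0],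
      ![0, 0, 1, 0, 0, 0, 0, 0, 0, 0], ![0, 0, 0, 1, 0, 0, 0, 0, 0, 0],
      ![0, 0, 0, 0, 1, 0, 0, 0, 0, 0], ![0, 0, 0, 0, 0, 1, 0, 0, 0, 0],
      ![0, 0, 0, 0, 0, 0, 1, 0, 0, 0], ![0, 0, 0, 0, 0, 0, 0, 1, 0, 0],
      ![0, 0, 0, 0, 0, 0, 0, 0, 1, 0], ![0, 0, 0, 0, 0, 0, 0, 0, 0, 1]] := by
  ext i j
  fin_cases i <;> fin_cases j <;> rfl

set_option maxHeartbeats 1000000 in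
theorem flatTable_gen {i j : Fin 10} (hij : i ≤ j) :
    flatTable (gen 0) (gen 1) (gen 2) (gen 3) (gen 4) (gen 5) (gen 6) (gen 7) (gen 8) (gen 9) i j
      = flatBracket (gen i) (gen j) := by
  rw [gen_eq]
  fin_cases i <;> fin_cases j <;> first | (exact absurd hij (by decide)) | skip
  all_goals
    simp [flatTable, flatBracket]
  all_goals
    ext k
    fin_cases k <;> rfl

theorem map_flatTable {V W : Type*} [AddCommGroup V] [Module ℝ V] [AddCommGroup W] [Module ℝ W]
    (f : V →ₗ[ℝ] W) (X : Fin 10 → V) (i j : Fin 10) :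
    f (flatTable (X 0) (X 1) (X 2) (X 3) (X 4) (X 5) (X 6) (X 7) (X 8) (X 9) i j) =
      flatTable (f (X 0)) (f (X 1)) (f (X 2)) (f (X 3)) (f (X 4)) (f (X 5)) (f (X 6)) (f (X 7))
        (f (X 8)) (f (X 9)) i j := by
  fin_cases i <;> fin_cases j <;> simp [flatTable]

/-- The generators split into translations (indices 6, 8, 9), linear fields (2, 4, 5, 7) and
quadratic fields (0, 1, 3). Brackets with translations lower the degree, so a nonzero ideal contains
a nonzero translation; the linear fields then produce ∂_y, and ∂_y generates everything. -/
theorem eq_bot_or_eq_top_of_flatBracket_mem (S : Submodule ℝ (Fin 10 → ℝ))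
    (hS : ∀ c d, d ∈ S → flatBracket c d ∈ S) : S = ⊥ ∨ S = ⊤ := by
  have key : ∀ (a : ℝ) (v w : Fin 10 → ℝ), a ≠ 0 → v ∈ S → v = a • w → w ∈ S := by
    rintro a v w ha hv rfl
    exact (S.smul_mem_iff ha).1 hv
  have top_of_8 : gen 8 ∈ S → S = ⊤ := by
    intro h8
    -- The linear field X₃ sends ∂_y to ∂_x and ∂_x to ∂_z, up to scalars; brackets with quadratic
    -- fields then give linear ones, and these give the quadratic ones.
    have h6 : gen 6 ∈ S := key (-1) _ _ (by norm_num) (hS (gen 2) _ h8) (by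
      rw [gen_eq]; simp [flatBracket])
    have h9 : gen 9 ∈ S := key 2 _ _ (by norm_num) (hS (gen 2) _ h6) (by
      rw [gen_eq]; simp [flatBracket])
    have h2 : gen 2 ∈ S := key (-1) _ _ (by norm_num) (hS (gen 0) _ h6) (by
      rw [gen_eq]; simp [flatBracket])
    have h4 : gen 4 ∈ S := key (-1) _ _ (by norm_num) (hS (gen 3) _ h6) (by
      rw [gen_eq]; simp [flatBracket])
    have h5 : gen 5 ∈ S := key (-1) _ _ (by norm_num) (hS (gen 3) _ h9) (by
      rw [gen_eq]; simp [flatBracket])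
    have h7 : gen 7 ∈ S := key (-2) _ _ (by norm_num) (hS (gen 2) _ h4) (by
      rw [gen_eq]; simp [flatBracket])
    have h0 : gen 0 ∈ S := key (-1) _ _ (by norm_num) (hS (gen 0) _ h7) (by
      rw [gen_eq]; simp [flatBracket])
    have h1 : gen 1 ∈ S := key (-1) _ _ (by norm_num) (hS (gen 1) _ h5) (by
      rw [gen_eq]; simp [flatBracket])
    have h3 : gen 3 ∈ S := key 1 _ _ (by norm_num) (hS (gen 3) _ h7) (by
      rw [gen_eq]; simp [flatBracket])
    rw [eq_top_iff]
    intro c _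
    rw [pi_eq_sum_univ' c]
    refine S.sum_mem fun i _ => S.smul_mem _ ?_
    fin_cases i <;> assumption
  have top_of_6 : gen 6 ∈ S → S = ⊤ := fun h6 => top_of_8 <|
    key 2 _ _ (by norm_num) (hS (gen 4) _ h6) (by rw [gen_eq]; simp [flatBracket])
  have top_of_9 : gen 9 ∈ S → S = ⊤ := fun h9 => top_of_6 <|
    key (-1) _ _ (by norm_num) (hS (gen 4) _ h9) (by rw [gen_eq]; simp [flatBracket])
  -- X₅ acts nilpotently by ∂_z → ∂_x → ∂_y → 0 and X₃ by ∂_y → ∂_x → ∂_z → 0, up to scalars; two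
  -- applications isolate one coefficient.
  have top_of_translation : ∀ a b c : ℝ, ![0, 0, 0, 0, 0, 0, a, 0, b, c] ∈ S →
      (a ≠ 0 ∨ b ≠ 0 ∨ c ≠ 0) → S = ⊤ := by
    intro a b c h habc
    by_cases hb : b = 0
    · by_cases hc : c = 0
      · have ha : a ≠ 0 := by simpa [hb, hc] using habc
        exact top_of_6 (key a _ _ ha h (by rw [gen_eq]; simp [hb, hc]))
      · exact top_of_8 (key (-2 * c) _ _ (by simpa using hc) (hS (gen 4) _ (hS (gen 4) _ h)) (by
          rw [gen_eq]; simp [flatBracket]))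
    · exact top_of_9 (key (-2 * b) _ _ (by simpa using hb) (hS (gen 2) _ (hS (gen 2) _ h)) (by
        rw [gen_eq]; simp [flatBracket]))
  rw [or_iff_not_imp_left]
  intro hbot
  obtain ⟨c, hc, hc0⟩ := S.ne_bot_iff.1 hbot
  -- A double bracket with a translation kills linear fields and translations. With ∂_y or ∂_z it
  -- sees a single quadratic coefficient; with ∂_x it does so once `c 0` and `c 3` vanish.
  by_cases h0 : c 0 = 0
  swap
  · refine top_of_8 (key (2 * c 0) _ _ (by simpa using h0) (hS (gen 8) _ (hS (gen 8) _ hc)) ?_)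
    rw [gen_eq]; simp [flatBracket]
  by_cases h3 : c 3 = 0
  swap
  · refine top_of_9 (key (2 * c 3) _ _ (by simpa using h3) (hS (gen 9) _ (hS (gen 9) _ hc)) ?_)
    rw [gen_eq]; simp [flatBracket]
  by_cases h1 : c 1 = 0
  swap
  · refine top_of_6 (key (-2 * c 1) _ _ (by simpa using h1) (hS (gen 6) _ (hS (gen 6) _ hc)) ?_)
    rw [gen_eq]; simp [flatBracket, h0, h3]
  -- The quadratic part is now zero, so brackets of `c` with translations are translations.
  have t6 : ![0, 0, 0, 0, 0, 0, c 5, 0, -2 * c 4, -2 * c 2] ∈ S := by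
    convert hS (gen 6) _ hc using 1
    rw [gen_eq]; simp [flatBracket, h0, h1, h3]
  have t8 : ![0, 0, 0, 0, 0, 0, c 2, 0, c 7, 0] ∈ S := by
    convert hS (gen 8) _ hc using 1
    rw [gen_eq]; simp [flatBracket, h0, h1, h3]
  have t9 : ![0, 0, 0, 0, 0, 0, c 4, 0, 0, 2 * c 5 - c 7] ∈ S := by
    convert hS (gen 9) _ hc using 1
    rw [gen_eq]; simp [flatBracket, h0, h1, h3, sub_eq_add_neg]
  by_cases h2 : c 2 = 0
  swap
  · exact top_of_translation _ _ _ t8 (Or.inl h2)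
  by_cases h4 : c 4 = 0
  swap
  · exact top_of_translation _ _ _ t9 (Or.inl h4)
  by_cases h5 : c 5 = 0
  swap
  · exact top_of_translation _ _ _ t6 (Or.inl h5)
  by_cases h7 : c 7 = 0
  swap
  · exact top_of_translation _ _ _ t8 (Or.inr (Or.inl h7))
  refine top_of_translation (c 6) (c 8) (c 9) ?_ ?_
  · convert hc using 1
    ext i
    fin_cases i <;> simp [*]
  · by_contra! h
    obtain ⟨h6, h8, h9⟩ := h
    refine hc0 (funext fun i => ?_)
    fin_cases i <;> simp [*]

/-! ### The isomorphism with so(3,2) -/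

/-- The matrix in `so(3,2)` with coefficient vector `c`. -/
def soMatrix (c : Fin 10 → ℝ) : Matrix (Fin 3 ⊕ Fin 2) (Fin 3 ⊕ Fin 2) ℝ :=
  Matrix.fromBlocks
    !![0, -(c 2 + c 4), c 1 - c 6;
      c 2 + c 4, 0, -(c 0 + c 3 + c 8 + c 9) / 2;
      c 6 - c 1, (c 0 + c 3 + c 8 + c 9) / 2, 0]
    !![c 4 - c 2, -(c 1 + c 6);
      c 5 - c 7, (c 0 + c 3 - c 8 - c 9) / 2;
      (c 0 + c 9 - c 3 - c 8) / 2, c 5]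
    !![c 4 - c 2, c 5 - c 7, (c 0 + c 9 - c 3 - c 8) / 2;
      -(c 1 + c 6), (c 0 + c 3 - c 8 - c 9) / 2, c 5]
    !![0, (c 3 + c 9 - c 0 - c 8) / 2;
      (c 0 + c 8 - c 3 - c 9) / 2, 0]

set_option maxHeartbeats 2000000 in
theorem soMatrix_bracket (c d : Fin 10 → ℝ) :
    ⁅soMatrix c, soMatrix d⁆ = soMatrix (flatBracket c d) := by
  rw [Ring.lie_def, soMatrix, soMatrix, Matrix.fromBlocks_multiply, Matrix.fromBlocks_multiply]
  ext (i | i) (j | j) <;> fin_cases i <;> fin_cases j <;>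
    simp [soMatrix, flatBracket] <;> ring

theorem mem_so'_iff (A : Matrix (Fin 3 ⊕ Fin 2) (Fin 3 ⊕ Fin 2) ℝ) :
    A ∈ LieAlgebra.Orthogonal.so' (Fin 3) (Fin 2) ℝ ↔
      A.transpose * LieAlgebra.Orthogonal.indefiniteDiagonal (Fin 3) (Fin 2) ℝ =
        LieAlgebra.Orthogonal.indefiniteDiagonal (Fin 3) (Fin 2) ℝ * -A := by
  rw [LieAlgebra.Orthogonal.so', mem_skewAdjointMatricesLieSubalgebra,
    mem_skewAdjointMatricesSubmodule]
  rfl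

theorem soMatrix_mem (c : Fin 10 → ℝ) :
    soMatrix c ∈ LieAlgebra.Orthogonal.so' (Fin 3) (Fin 2) ℝ := by
  rw [mem_so'_iff]
  ext (i | i) (j | j) <;> fin_cases i <;> fin_cases j <;>
    simp [soMatrix, LieAlgebra.Orthogonal.indefiniteDiagonal] <;> ring

/-- The parametrization of `so(3,2)` by coefficient vectors. -/
def soLinear : (Fin 10 → ℝ) →ₗ[ℝ] LieAlgebra.Orthogonal.so' (Fin 3) (Fin 2) ℝ where
  toFun c := ⟨soMatrix c, soMatrix_mem c⟩
  map_add' c d := by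
    ext (i | i) (j | j) <;> fin_cases i <;> fin_cases j <;> simp [soMatrix] <;> ring
  map_smul' a c := by
    ext (i | i) (j | j) <;> fin_cases i <;> fin_cases j <;> simp [soMatrix] <;> ring

theorem soLinear_bracket (c d : Fin 10 → ℝ) :
    ⁅soLinear c, soLinear d⁆ = soLinear (flatBracket c d) :=
  Subtype.ext (soMatrix_bracket c d)

theorem soLinear_coe (c : Fin 10 → ℝ) :
    (soLinear c : Matrix (Fin 3 ⊕ Fin 2) (Fin 3 ⊕ Fin 2) ℝ) = soMatrix c :=
  rfl

/-- The kernel is an ideal, and it is not everything because the sixth generator has a nonzero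
matrix. Surjectivity solves for the coefficients from the ten independent entries of a matrix in
so(3,2). -/
theorem soLinear_bijective : Function.Bijective soLinear := by
  constructor
  · rw [← LinearMap.ker_eq_bot]
    refine (eq_bot_or_eq_top_of_flatBracket_mem _ fun c d hd => ?_).resolve_right fun h => ?_
    · rw [LinearMap.mem_ker] at hd ⊢
      rw [← soLinear_bracket, hd, lie_zero]
    · have h5 : gen 5 ∈ LinearMap.ker soLinear := h ▸ Submodule.mem_top
      have h5' := soLinear_coe (gen 5)
      rw [LinearMap.mem_ker.1 h5] at h5'
      have := congr_fun (congr_fun h5' (.inl 2)) (.inr 1)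
      simp [soMatrix] at this
  · rintro ⟨A, hA⟩
    have hA' := (mem_so'_iff A).1 hA
    have e := fun i j => congr_fun (congr_fun hA' i) j
    simp only [LieAlgebra.Orthogonal.indefiniteDiagonal, Matrix.mul_diagonal,
      Matrix.diagonal_mul, Matrix.transpose_apply, Matrix.neg_apply] at e
    have hll : ∀ i j, A (.inl j) (.inl i) = -A (.inl i) (.inl j) := fun i j => by
      simpa using e (.inl i) (.inl j)
    have hrr : ∀ i j, A (.inr j) (.inr i) = -A (.inr i) (.inr j) := fun i j => by
      have := e (.inr i) (.inr j)
      simp at this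
      linarith
    have hrl : ∀ i j, A (.inr j) (.inl i) = A (.inl i) (.inr j) := fun i j => by
      simpa using e (.inl i) (.inr j)
    have hl : ∀ i, A (.inl i) (.inl i) = 0 := fun i => by linarith [hll i i]
    have hr : ∀ i, A (.inr i) (.inr i) = 0 := fun i => by linarith [hrr i i]
    let a := A (.inl 2) (.inl 1)
    let b := A (.inl 1) (.inr 1)
    let k := A (.inl 2) (.inr 0)
    let l := A (.inr 0) (.inr 1)
    -- Sums and differences of the entries in `soMatrix` invert the parametrization; `a`, `b`, `k`,
    -- `l` are the four entries that mix `c 0`, `c 3`, `c 8`, `c 9`.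
    refine ⟨![(a + b + k - l) / 2, (A (.inl 0) (.inl 2) - A (.inl 0) (.inr 1)) / 2,
      (A (.inl 1) (.inl 0) - A (.inl 0) (.inr 0)) / 2, (a + b - k + l) / 2,
      (A (.inl 1) (.inl 0) + A (.inl 0) (.inr 0)) / 2, A (.inl 2) (.inr 1),
      -(A (.inl 0) (.inl 2) + A (.inl 0) (.inr 1)) / 2,
      A (.inl 2) (.inr 1) - A (.inl 1) (.inr 0), (a - b - k - l) / 2, (a - b + k + l) / 2],
      Subtype.ext ?_⟩
    rw [soLinear_coe]
    ext (i | i) (j | j) <;> fin_cases i <;> fin_cases j <;>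
      simp [soMatrix, hl, hr, hrl, a, b, k, l] <;>
      linarith [hll 0 1, hll 0 2, hll 1 2, hrr 0 1]

/-! ### The wedge conditions as linear conditions on kernels -/

/-- The vectors `e` are dual to the covectors `α`. On `(v, e)` with `v` in the common kernel, the
determinant reduces to `ξ v`. Conversely, `ξ` vanishing on that kernel equals `∑ ξ(eᵢ) αᵢ`, a
dependence between the rows of every determinant. -/
theorem wedge_vecCons_eq_zero_iff {k : ℕ} (ξ : Jet →L[ℝ] ℝ) (α : Fin k → (Jet →L[ℝ] ℝ))
    (e : Fin k → Jet) (he : ∀ i j, α i (e j) = (1 : Matrix (Fin k) (Fin k) ℝ) i j) :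
    wedge (Matrix.vecCons ξ α) = 0 ↔ ∀ v, (∀ i, α i v = 0) → ξ v = 0 := by
  constructor
  · intro h v hv
    have h' := wedge_apply (Matrix.vecCons ξ α) (Matrix.vecCons v e)
    rw [h, Matrix.det_succ_column_zero, Fin.sum_univ_succ, Finset.sum_eq_zero] at h'
    · have h1 : (Matrix.of fun i j =>
          (Matrix.vecCons ξ α : Fin (k + 1) → (Jet →L[ℝ] ℝ)) i
            ((Matrix.vecCons v e : Fin (k + 1) → Jet) j)).submatrix
          (Fin.succAbove 0) Fin.succ = 1 := by
        ext i j
        simp [he]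
      rw [h1] at h'
      simpa using h'.symm
    · intro i _
      simp [hv]
  · intro h
    ext v
    rw [wedge_apply, AlternatingMap.zero_apply]
    refine Matrix.exists_vecMul_eq_zero_iff.1
      ⟨Matrix.vecCons 1 fun i => -ξ (e i), fun h0 => ?_, ?_⟩
    · simpa using congr_fun h0 0
    · ext j
      have h2 := h (v j - ∑ i, α i (v j) • e i) fun i => by
        simp [he, Matrix.one_apply]
      simp only [map_sub, map_sum, map_smul, smul_eq_mul] at h2
      simp only [Matrix.vecMul, dotProduct, Fin.sum_univ_succ, Matrix.cons_val_zero,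
        Matrix.cons_val_succ, Matrix.of_apply, one_mul, neg_mul, Finset.sum_neg_distrib,
        Pi.zero_apply]
      rw [← sub_eq_add_neg, ← h2]
      simp only [mul_comm]

theorem hasFDerivAt_coord (i : Fin 5) (q : Jet) : HasFDerivAt (fun q : Jet => q i) (dcoord i) q :=
  (dcoord i).hasFDerivAt

theorem hasFDerivAt_flatF (q : Jet) : HasFDerivAt flatF (((1 / 2) * q 3) • dcoord 3) q := by
  refine (((hasFDerivAt_coord 3 q).pow 2).const_mul (1 / 4)).congr_fderiv ?_
  ext v
  simp
  ring

theorem totalD_flatF : totalD flatH flatF = fun q => (1 / 2) * q 3 * q 4 := by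
  ext q
  simp [totalD, pd, (hasFDerivAt_flatF q).fderiv, dcoord, flatH]
  ring

theorem hasFDerivAt_totalD_flatF (q : Jet) : HasFDerivAt (fun q : Jet => (1 / 2) * q 3 * q 4)
    (((1 / 2) * q 4) • dcoord 3 + ((1 / 2) * q 3) • dcoord 4) q := by
  refine (((hasFDerivAt_coord 3 q).const_mul (1 / 2)).mul (hasFDerivAt_coord 4 q)).congr_fderiv ?_
  ext v
  simp
  ring

theorem totalD_totalD_flatF : totalD flatH (totalD flatH flatF) = fun q => (1 / 2) * q 4 ^ 2 := by
  ext q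
  rw [totalD_flatF]
  simp only [totalD, pd, (hasFDerivAt_totalD_flatF q).fderiv]
  simp [dcoord, flatH]
  ring

theorem lieDerivative_coframe (X : Jet → Jet) (i : Fin 5) {f g : Jet → ℝ} {f' g' : Jet →L[ℝ] ℝ}
    {q : Jet} (hf : HasFDerivAt f f' q) (hg : HasFDerivAt g g' q) (v : Jet) :
    lieDerivative X (fun q => dcoord i - f q • dcoord 0 - g q • dcoord 1) q v =
      fderiv ℝ X q v i - f q * fderiv ℝ X q v 0 - g q * fderiv ℝ X q v 1
        - f' (X q) * v 0 - g' (X q) * v 1 := by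
  have h : HasFDerivAt (fun q => dcoord i - f q • dcoord 0 - g q • dcoord 1) _ q :=
    ((hasFDerivAt_const (dcoord i) q).sub (hf.smul_const (dcoord 0))).sub
      (hg.smul_const (dcoord 1))
  rw [lieDerivative, h.fderiv]
  simp [dcoord]
  ring

theorem lieDerivative_omega1 (X : Jet → Jet) (q v : Jet) :
    lieDerivative X (omega1 flatF) q v =
      fderiv ℝ X q v 2 - q 3 * fderiv ℝ X q v 0 - (1 / 4) * q 3 ^ 2 * fderiv ℝ X q v 1
        - X q 3 * v 0 - (1 / 2) * q 3 * X q 3 * v 1 := by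
  unfold omega1
  rw [lieDerivative_coframe X 2 (hasFDerivAt_coord 3 q) (hasFDerivAt_flatF q)]
  simp [dcoord, flatF]

theorem lieDerivative_omega2 (X : Jet → Jet) (q v : Jet) :
    lieDerivative X (omega2 flatF flatH) q v =
      fderiv ℝ X q v 3 - q 4 * fderiv ℝ X q v 0 - (1 / 2) * q 3 * q 4 * fderiv ℝ X q v 1
        - X q 4 * v 0 - (1 / 2) * (X q 3 * q 4 + q 3 * X q 4) * v 1 := by
  unfold omega2
  rw [totalD_flatF, lieDerivative_coframe X 3 (hasFDerivAt_coord 4 q) (hasFDerivAt_totalD_flatF q)]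
  simp [dcoord]
  exact Or.inl (by ring)

theorem lieDerivative_omega3 (X : Jet → Jet) (q v : Jet) :
    lieDerivative X (omega3 flatF flatH) q v =
      fderiv ℝ X q v 4 - (1 / 2) * q 4 ^ 2 * fderiv ℝ X q v 1 - q 4 * X q 4 * v 1 := by
  unfold omega3
  rw [totalD_totalD_flatF, lieDerivative_coframe X 4 (f := flatH) (hasFDerivAt_const (0 : ℝ) q)
    (((hasFDerivAt_coord 4 q).pow 2).const_mul (1 / 2))]
  simp [dcoord, flatH]
  exact Or.inl (by ring)

theorem lieDerivative_dcoord (X : Jet → Jet) (i : Fin 5) (q v : Jet) :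
    lieDerivative X (fun _ => dcoord i) q v = fderiv ℝ X q v i := by
  simp [lieDerivative, dcoord]

theorem omega1_apply (q v : Jet) :
    omega1 flatF q v = v 2 - q 3 * v 0 - (1 / 4) * q 3 ^ 2 * v 1 := by
  simp [omega1, dcoord, flatF]

theorem omega2_apply (q v : Jet) :
    omega2 flatF flatH q v = v 3 - q 4 * v 0 - (1 / 2) * q 3 * q 4 * v 1 := by
  simp [omega2, dcoord, totalD_flatF]

theorem omega3_apply (q v : Jet) :
    omega3 flatF flatH q v = v 4 - (1 / 2) * q 4 ^ 2 * v 1 := by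
  simp [omega3, dcoord, totalD_totalD_flatF, flatH]

theorem isInfinitesimalPointSymmetry_flat_iff (U : Opens Jet) (X : Jet → Jet) :
    IsInfinitesimalPointSymmetry flatF flatH U X ↔ ∀ q ∈ U,
      (∀ v, omega1 flatF q v = 0 → lieDerivative X (omega1 flatF) q v = 0) ∧
      (∀ v, omega1 flatF q v = 0 → omega2 flatF flatH q v = 0 → omega3 flatF flatH q v = 0 →
        lieDerivative X (omega2 flatF flatH) q v = 0 ∧
        lieDerivative X (omega3 flatF flatH) q v = 0) ∧
      (∀ v, omega1 flatF q v = 0 → v 0 = 0 → v 1 = 0 →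
        fderiv ℝ X q v 0 = 0 ∧ fderiv ℝ X q v 1 = 0) := by
  refine forall₂_congr fun q _ => ?_
  -- Each of the three equivalences is given an explicit family of vectors dual to the covectors
  -- following `ξ`.
  have w1 : ∀ ξ : Jet →L[ℝ] ℝ, wedge ![ξ, omega1 flatF q] = 0 ↔
      ∀ v, omega1 flatF q v = 0 → ξ v = 0 := fun ξ => by
    rw [wedge_vecCons_eq_zero_iff ξ ![omega1 flatF q] ![Pi.single 2 1]]
    · simp
    · intro i j
      fin_cases i; fin_cases j; simp [omega1_apply]
  have w2 : ∀ ξ : Jet →L[ℝ] ℝ,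
      wedge ![ξ, omega1 flatF q, omega2 flatF flatH q, omega3 flatF flatH q] = 0 ↔
      ∀ v, omega1 flatF q v = 0 → omega2 flatF flatH q v = 0 → omega3 flatF flatH q v = 0 →
        ξ v = 0 := fun ξ => by
    rw [wedge_vecCons_eq_zero_iff ξ ![omega1 flatF q, omega2 flatF flatH q, omega3 flatF flatH q]
      ![Pi.single 2 1, Pi.single 3 1, Pi.single 4 1]]
    · simp [Fin.forall_fin_succ]
    · intro i j
      fin_cases i <;> fin_cases j <;> simp [omega1_apply, omega2_apply, omega3_apply]
  have w3 : ∀ ξ : Jet →L[ℝ] ℝ,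
      wedge ![ξ, omega1 flatF q, omega4 q, omega5 q] = 0 ↔
      ∀ v, omega1 flatF q v = 0 → v 0 = 0 → v 1 = 0 → ξ v = 0 := fun ξ => by
    rw [wedge_vecCons_eq_zero_iff ξ ![omega1 flatF q, omega4 q, omega5 q]
      ![Pi.single 2 1, ![1, 0, q 3, 0, 0], ![0, 1, (1 / 4) * q 3 ^ 2, 0, 0]]]
    · simp [Fin.forall_fin_succ, omega4, omega5, dcoord]
    · intro i j
      fin_cases i <;> fin_cases j <;> simp [omega1_apply, omega4, omega5, dcoord]
  rw [w1, w2, w2, w3, w3]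
  constructor
  · rintro ⟨h1, h2, h3, h4, h5⟩
    exact ⟨h1, fun v a b c => ⟨h2 v a b c, h3 v a b c⟩, fun v a b c =>
      ⟨(lieDerivative_dcoord X 0 q v).symm.trans (h4 v a b c),
        (lieDerivative_dcoord X 1 q v).symm.trans (h5 v a b c)⟩⟩
  · rintro ⟨h1, h2, h3⟩
    exact ⟨h1, fun v a b c => (h2 v a b c).1, fun v a b c => (h2 v a b c).2,
      fun v a b c => (lieDerivative_dcoord X 0 q v).trans (h3 v a b c).1,
      fun v a b c => (lieDerivative_dcoord X 1 q v).trans (h3 v a b c).2⟩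

/-! ### The ten-parameter family of polynomial symmetries -/

/-- The polynomial vector field with coefficient vector `c`. -/
def flatCombo (c : Fin 10 → ℝ) : Jet → Jet := fun q =>
  ![c 0 * (q 0 * q 1) - c 1 * (q 0 ^ 2 - q 1 * q 2) + c 2 * q 1 + c 3 * (q 0 * q 2) + c 4 * q 2
      + c 5 * q 0 + c 6,
    c 0 * q 1 ^ 2 - c 1 * (2 * q 0 * q 1) - c 3 * q 0 ^ 2 - c 4 * (2 * q 0) + c 7 * q 1 + c 8,
    -c 0 * q 0 ^ 2 - c 1 * (2 * q 0 * q 2) - c 2 * (2 * q 0) + c 3 * q 2 ^ 2 + c 5 * (2 * q 2)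
      - c 7 * q 2 + c 9,
    -c 0 * (q 3 * q 1 + 2 * q 0) - c 1 * ((1 / 2) * q 3 ^ 2 * q 1 + 2 * q 2) - c 2 * 2
      - c 3 * ((1 / 2) * q 3 ^ 2 * q 0 - q 3 * q 2) - c 4 * ((1 / 2) * q 3 ^ 2) + c 5 * q 3
      - c 7 * q 3,
    -c 0 * (2 * q 4 * q 1 + 2) - c 1 * (q 3 * q 4 * q 1 - 2 * q 4 * q 0 + 2 * q 3)
      + c 3 * ((1 / 2) * q 3 ^ 2 - q 3 * q 4 * q 0) - c 4 * (q 3 * q 4) - c 7 * q 4]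

/-- The derivative of `flatCombo c` at `q` in the direction `v`. -/
def flatComboDeriv (c : Fin 10 → ℝ) (q v : Jet) : Jet :=
  ![c 0 * (v 0 * q 1 + q 0 * v 1) - c 1 * (2 * q 0 * v 0 - v 1 * q 2 - q 1 * v 2) + c 2 * v 1
      + c 3 * (v 0 * q 2 + q 0 * v 2) + c 4 * v 2 + c 5 * v 0,
    c 0 * (2 * q 1 * v 1) - c 1 * (2 * v 0 * q 1 + 2 * q 0 * v 1) - c 3 * (2 * q 0 * v 0)
      - c 4 * (2 * v 0) + c 7 * v 1,
    -c 0 * (2 * q 0 * v 0) - c 1 * (2 * v 0 * q 2 + 2 * q 0 * v 2) - c 2 * (2 * v 0)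
      + c 3 * (2 * q 2 * v 2) + c 5 * (2 * v 2) - c 7 * v 2,
    -c 0 * (v 3 * q 1 + q 3 * v 1 + 2 * v 0)
      - c 1 * (q 3 * v 3 * q 1 + (1 / 2) * q 3 ^ 2 * v 1 + 2 * v 2)
      - c 3 * (q 3 * v 3 * q 0 + (1 / 2) * q 3 ^ 2 * v 0 - v 3 * q 2 - q 3 * v 2)
      - c 4 * (q 3 * v 3) + c 5 * v 3 - c 7 * v 3,
    -c 0 * (2 * v 4 * q 1 + 2 * q 4 * v 1)
      - c 1 * (v 3 * q 4 * q 1 + q 3 * v 4 * q 1 + q 3 * q 4 * v 1 - 2 * v 4 * q 0 - 2 * q 4 * v 0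
        + 2 * v 3)
      + c 3 * (q 3 * v 3 - v 3 * q 4 * q 0 - q 3 * v 4 * q 0 - q 3 * q 4 * v 0)
      - c 4 * (v 3 * q 4 + q 3 * v 4) - c 7 * v 4]

theorem contDiff_flatCombo (c : Fin 10 → ℝ) : ContDiff ℝ ∞ (flatCombo c) := by
  rw [contDiff_pi]
  intro i
  fin_cases i <;> simp only [flatCombo] <;> simp <;> fun_prop

theorem fderiv_flatCombo (c : Fin 10 → ℝ) (q v : Jet) :
    fderiv ℝ (flatCombo c) q v = flatComboDeriv c q v := by
  have hd : DifferentiableAt ℝ (flatCombo c) q :=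
    (contDiff_flatCombo c).differentiable (by simp) q
  -- Restricting to the line `q + t • v` reduces the derivative to product rules in one variable.
  have hl : HasDerivAt (fun t : ℝ => q + t • v) v 0 := by
    simpa using ((hasDerivAt_id (0 : ℝ)).smul_const v).const_add q
  have h1 : HasDerivAt (fun t : ℝ => flatCombo c (q + t • v)) (fderiv ℝ (flatCombo c) q v) 0 := by
    have hd' : HasFDerivAt (flatCombo c) (fderiv ℝ (flatCombo c) q) (q + (0 : ℝ) • v) := by
      simpa using hd.hasFDerivAt
    exact hd'.comp_hasDerivAt (0 : ℝ) hl
  refine h1.unique ?_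
  rw [hasDerivAt_pi]
  have h : ∀ i, HasDerivAt (fun t : ℝ => (q + t • v) i) (v i) 0 := hasDerivAt_pi.1 hl
  intro i
  fin_cases i
  · convert (((((((((h 0).mul (h 1)).const_mul (c 0)).sub
      ((((h 0).pow 2).sub ((h 1).mul (h 2))).const_mul (c 1))).add ((h 1).const_mul (c 2))).add
      (((h 0).mul (h 2)).const_mul (c 3))).add ((h 2).const_mul (c 4))).add
      ((h 0).const_mul (c 5))).add (hasDerivAt_const 0 (c 6))) using 1
    · funext t
      simp [flatCombo]
    · simp [flatComboDeriv]
      exact Or.inl (by ring)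
  · convert ((((((((h 1).pow 2).const_mul (c 0)).sub
      ((((h 0).const_mul 2).mul (h 1)).const_mul (c 1))).sub (((h 0).pow 2).const_mul (c 3))).sub
      (((h 0).const_mul 2).const_mul (c 4))).add ((h 1).const_mul (c 7))).add
      (hasDerivAt_const 0 (c 8))) using 1
    · funext t
      simp [flatCombo]
    · simp [flatComboDeriv]
  · convert (((((((((h 0).pow 2).const_mul (-c 0)).sub
      ((((h 0).const_mul 2).mul (h 2)).const_mul (c 1))).sub
      (((h 0).const_mul 2).const_mul (c 2))).add (((h 2).pow 2).const_mul (c 3))).add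
      (((h 2).const_mul 2).const_mul (c 5))).sub ((h 2).const_mul (c 7))).add
      (hasDerivAt_const 0 (c 9))) using 1
    · funext t
      simp [flatCombo]
    · simp [flatComboDeriv]
  · convert ((((((((((h 3).mul (h 1)).add ((h 0).const_mul 2)).const_mul (-c 0)).sub
      ((((((h 3).pow 2).const_mul (1 / 2)).mul (h 1)).add ((h 2).const_mul 2)).const_mul
        (c 1))).sub (hasDerivAt_const 0 (c 2 * 2))).sub
      ((((((h 3).pow 2).const_mul (1 / 2)).mul (h 0)).sub ((h 3).mul (h 2))).const_mul
        (c 3))).sub ((((h 3).pow 2).const_mul (1 / 2)).const_mul (c 4))).add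
      ((h 3).const_mul (c 5))).sub ((h 3).const_mul (c 7))) using 1
    · funext t
      simp [flatCombo]
    · simp [flatComboDeriv]
      ring
  · convert (((((((((h 4).const_mul 2).mul (h 1)).add (hasDerivAt_const 0 2)).const_mul (-c 0)).sub
      ((((((h 3).mul (h 4)).mul (h 1)).sub (((h 4).const_mul 2).mul (h 0))).add
        ((h 3).const_mul 2)).const_mul (c 1))).add
      (((((h 3).pow 2).const_mul (1 / 2)).sub (((h 3).mul (h 4)).mul (h 0))).const_mul
        (c 3))).sub (((h 3).mul (h 4)).const_mul (c 4))).sub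
      ((h 4).const_mul (c 7))) using 1
    · funext t
      simp [flatCombo]
    · simp [flatComboDeriv]
      ring

theorem flatCombo_isInfinitesimalPointSymmetry (U : Opens Jet) (c : Fin 10 → ℝ) :
    IsInfinitesimalPointSymmetry flatF flatH U (flatCombo c) := by
  rw [isInfinitesimalPointSymmetry_flat_iff]
  intro q _
  refine ⟨fun v h1 => ?_, fun v h1 h2 h3 => ⟨?_, ?_⟩, fun v h1 h2 h3 => ⟨?_, ?_⟩⟩
  · rw [omega1_apply] at h1
    have e : v 2 = q 3 * v 0 + (1 / 4) * q 3 ^ 2 * v 1 := by linarith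
    rw [lieDerivative_omega1, fderiv_flatCombo]
    simp [flatComboDeriv, flatCombo, e]
    ring
  · rw [omega1_apply] at h1
    rw [omega2_apply] at h2
    have e1 : v 2 = q 3 * v 0 + (1 / 4) * q 3 ^ 2 * v 1 := by linarith
    have e2 : v 3 = q 4 * v 0 + (1 / 2) * q 3 * q 4 * v 1 := by linarith
    rw [lieDerivative_omega2, fderiv_flatCombo]
    simp [flatComboDeriv, flatCombo, e1, e2]
    ring
  · rw [omega1_apply] at h1
    rw [omega2_apply] at h2
    rw [omega3_apply] at h3
    have e1 : v 2 = q 3 * v 0 + (1 / 4) * q 3 ^ 2 * v 1 := by linarith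
    have e2 : v 3 = q 4 * v 0 + (1 / 2) * q 3 * q 4 * v 1 := by linarith
    have e3 : v 4 = (1 / 2) * q 4 ^ 2 * v 1 := by linarith
    rw [lieDerivative_omega3, fderiv_flatCombo]
    simp [flatComboDeriv, flatCombo, e2, e3]
    ring
  all_goals
    have e1 : v 2 = 0 := by
      rw [omega1_apply, h2, h3] at h1
      linarith
    rw [fderiv_flatCombo]
    simp [flatComboDeriv, e1, h2, h3]

theorem lieBracket_flatCombo (c d : Fin 10 → ℝ) (q : Jet) :
    VectorField.lieBracket ℝ (flatCombo c) (flatCombo d) q = flatCombo (flatBracket c d) q := by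
  rw [VectorField.lieBracket, fderiv_flatCombo, fderiv_flatCombo]
  ext i
  fin_cases i <;> simp [flatComboDeriv, flatCombo, flatBracket] <;> ring

theorem flatCombo_add (c d : Fin 10 → ℝ) : flatCombo (c + d) = flatCombo c + flatCombo d := by
  ext q i
  fin_cases i <;> simp [flatCombo] <;> ring

theorem flatCombo_smul (a : ℝ) (c : Fin 10 → ℝ) : flatCombo (a • c) = a • flatCombo c := by
  ext q i
  fin_cases i <;> simp [flatCombo] <;> ring

theorem flatCombo_gen (i : Fin 10) : flatCombo (gen i) = flatField i := by
  rw [gen_eq]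
  ext q j
  fin_cases i <;> fin_cases j <;> simp [flatCombo, flatField, flatFieldAt]

/-! ### Calculus of partial derivatives on an open set -/

section PartialDerivatives

variable {U : Opens Jet} {f g h : Jet → ℝ} {q : Jet}

theorem differentiableAt_of_contDiffOn (hf : ContDiffOn ℝ ∞ f U) (hq : q ∈ U) :
    DifferentiableAt ℝ f q :=
  (hf.contDiffAt (U.isOpen.mem_nhds hq)).differentiableAt (by simp)

theorem contDiffOn_pd (hf : ContDiffOn ℝ ∞ f U) (i : Fin 5) : ContDiffOn ℝ ∞ (pd i f) U :=
  (hf.fderiv_of_isOpen U.isOpen (m := ∞) (by simp)).clm_apply contDiffOn_const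

theorem pd_comm (hf : ContDiffOn ℝ ∞ f U) (i j : Fin 5) (hq : q ∈ U) :
    pd i (pd j f) q = pd j (pd i f) q := by
  have hc := hf.contDiffAt (U.isOpen.mem_nhds hq)
  have hs : IsSymmSndFDerivAt ℝ f q := hc.isSymmSndFDerivAt
    (by simpa using (mod_cast le_top : ((2 : ℕ∞) : ℕ∞ω) ≤ ∞))
  have hd : DifferentiableAt ℝ (fderiv ℝ f) q :=
    (hc.fderiv_right (m := ∞) (by simp)).differentiableAt (by simp)
  have key : ∀ i j : Fin 5,
      pd i (pd j f) q = fderiv ℝ (fderiv ℝ f) q (Pi.single i 1) (Pi.single j 1) := fun i j => by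
    unfold pd
    rw [fderiv_clm_apply hd (differentiableAt_const _)]
    simp
  rw [key, key, hs.eq]

theorem pd_congr (hfg : ∀ q ∈ U, f q = g q) (i : Fin 5) (hq : q ∈ U) : pd i f q = pd i g q := by
  have : f =ᶠ[nhds q] g := by
    filter_upwards [U.isOpen.mem_nhds hq] with q' hq' using hfg q' hq'
  rw [pd, pd, this.fderiv_eq]

theorem pd_eq_zero (hf : ∀ q ∈ U, f q = 0) (i : Fin 5) (hq : q ∈ U) : pd i f q = 0 := by
  rw [pd_congr (g := fun _ => 0) hf i hq]
  simp [pd]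

theorem pd_linear (hf : ContDiffOn ℝ ∞ f U) (hg : ContDiffOn ℝ ∞ g U) (hh : ContDiffOn ℝ ∞ h U)
    {a b c : ℝ} (h0 : ∀ q ∈ U, a * f q + b * g q + c * h q = 0) (i : Fin 5) :
    ∀ q ∈ U, a * pd i f q + b * pd i g q + c * pd i h q = 0 := by
  intro q hq
  have h1 := pd_eq_zero h0 i hq
  have h2 : HasFDerivAt (fun q => a * f q + b * g q + c * h q) _ q :=
    (((differentiableAt_of_contDiffOn hf hq).hasFDerivAt.const_mul a).add
      ((differentiableAt_of_contDiffOn hg hq).hasFDerivAt.const_mul b)).add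
      ((differentiableAt_of_contDiffOn hh hq).hasFDerivAt.const_mul c)
  rw [pd, h2.fderiv] at h1
  simpa [pd] using h1

theorem pd_pd_eq_zero (hf : ContDiffOn ℝ ∞ f U) {i : Fin 5} (h0 : ∀ q ∈ U, pd i f q = 0)
    (j : Fin 5) : ∀ q ∈ U, pd i (pd j f) q = 0 := fun q hq => by
  rw [pd_comm hf i j hq, pd_eq_zero h0 j hq]

theorem fderiv_eq_sum_pd (f : Jet → ℝ) (q v : Jet) :
    fderiv ℝ f q v = ∑ i, v i * pd i f q := by
  conv_lhs => rw [pi_eq_sum_univ' v]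
  simp [pd]

theorem eq_zero_of_pd_eq_zero (hU : IsPreconnected (U : Set Jet)) (hf : ContDiffOn ℝ ∞ f U)
    (h0 : ∀ i, ∀ q ∈ U, pd i f q = 0) {q₀ : Jet} (hq₀ : q₀ ∈ U) (hf₀ : f q₀ = 0) :
    ∀ q ∈ U, f q = 0 := fun q hq => by
  rw [← hf₀]
  refine U.isOpen.is_const_of_fderiv_eq_zero hU
    (fun x hx => (differentiableAt_of_contDiffOn hf hx).differentiableWithinAt)
    (fun x hx => ?_) hq hq₀
  ext v
  rw [fderiv_eq_sum_pd]
  simp [h0 _ x hx]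

/-- A polynomial in one coordinate, with coefficients independent of it, vanishes on an open set
only if its coefficients do. Differentiating in that coordinate lowers the degree and replaces the
coefficients by `(k + 1) * f (k + 1)`, which drives the induction. -/
theorem eq_zero_of_sum_pow_mul_eq_zero (j : Fin 5) (n : ℕ) : ∀ f : ℕ → Jet → ℝ,
    (∀ k, ContDiffOn ℝ ∞ (f k) U) → (∀ k, ∀ q ∈ U, pd j (f k) q = 0) →
    (∀ q ∈ U, ∑ k ∈ Finset.range n, q j ^ k * f k q = 0) →
    ∀ k < n, ∀ q ∈ U, f k q = 0 := by
  induction n with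
  | zero => intro f _ _ _ k hk; omega
  | succ n ih =>
    intro f hf hp hs
    have hsucc : ∀ k < n, ∀ q ∈ U, f (k + 1) q = 0 := by
      intro k hk q hq
      have := ih (fun k q => ((k : ℝ) + 1) * f (k + 1) q)
        (fun k => contDiffOn_const.mul (hf (k + 1))) (fun k q hq => ?_) (fun q hq => ?_) k hk q hq
      · have hk0 : (k : ℝ) + 1 ≠ 0 := by positivity
        simpa [hk0] using this
      · rw [pd, fderiv_const_mul (differentiableAt_of_contDiffOn (hf _) hq)]
        have := hp (k + 1) q hq
        rw [pd] at this
        simp [this]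
      · have h1 := pd_eq_zero hs j hq
        have h2 : HasFDerivAt (fun q : Jet => ∑ k ∈ Finset.range (n + 1), q j ^ k * f k q) _ q :=
          HasFDerivAt.fun_sum fun k _ => ((hasFDerivAt_coord j q).pow k).mul
            (differentiableAt_of_contDiffOn (hf k) hq).hasFDerivAt
        rw [pd, h2.fderiv, sum_apply, Finset.sum_range_succ'] at h1
        have h3 : ∀ k, fderiv ℝ (f k) q (Pi.single j 1) = 0 := fun k => hp k q hq
        simp [h3, dcoord] at h1
        rw [← h1]
        refine Finset.sum_congr rfl fun k _ => ?_
        ring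
    intro k hk q hq
    rcases k with _ | k
    · have h1 := hs q hq
      rw [Finset.sum_range_succ', Finset.sum_eq_zero] at h1
      · simpa using h1
      · intro k hk
        rw [hsucc k (Finset.mem_range.1 hk) q hq, mul_zero]
    · exact hsucc k (by omega) q hq

end PartialDerivatives

/-! ### The determining equations and their rigidity -/

section Determination

variable {U : Opens Jet}

/-- The `i`-th component of a vector field. -/
def comp (X : Jet → Jet) (i : Fin 5) : Jet → ℝ := fun q => X q i

theorem contDiffOn_comp {X : Jet → Jet} (hX : ContDiffOn ℝ ∞ X U) (i : Fin 5) :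
    ContDiffOn ℝ ∞ (comp X i) U :=
  contDiffOn_pi.1 hX i

theorem fderiv_comp {X : Jet → Jet} (hX : ContDiffOn ℝ ∞ X U) {q : Jet} (hq : q ∈ U) (v : Jet)
    (i : Fin 5) : fderiv ℝ X q v i = ∑ j, v j * pd j (comp X i) q := by
  rw [← fderiv_eq_sum_pd]
  have hd : DifferentiableAt ℝ X q :=
    (hX.contDiffAt (U.isOpen.mem_nhds hq)).differentiableAt (by simp)
  have h : HasFDerivAt (comp X i) _ q := hasFDerivAt_pi'.1 hd.hasFDerivAt i
  rw [h.fderiv]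
  rfl

/-- The determining equations of the infinitesimal point symmetries of the flat model: the
components along `∂_x, ∂_y, ∂_z` only depend on `(x, y, z)` and form a conformal Killing field of
the metric `dx² + dy dz`. -/
structure IsFlatKilling (U : Opens Jet) (A B C : Jet → ℝ) : Prop where
  A_p : ∀ q ∈ U, pd 3 A q = 0
  A_r : ∀ q ∈ U, pd 4 A q = 0
  B_p : ∀ q ∈ U, pd 3 B q = 0
  B_r : ∀ q ∈ U, pd 4 B q = 0
  C_p : ∀ q ∈ U, pd 3 C q = 0
  C_r : ∀ q ∈ U, pd 4 C q = 0
  B_z : ∀ q ∈ U, pd 2 B q = 0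
  C_y : ∀ q ∈ U, pd 1 C q = 0
  eq_x : ∀ q ∈ U, 2 * pd 0 A q + -1 * pd 2 C q + -1 * pd 1 B q = 0
  eq_y : ∀ q ∈ U, 2 * pd 1 A q + 1 * pd 0 C q + 0 * pd 0 C q = 0
  eq_z : ∀ q ∈ U, 2 * pd 2 A q + 1 * pd 0 B q + 0 * pd 0 B q = 0

theorem IsInfinitesimalPointSymmetry.isFlatKilling {X : Jet → Jet} (hX : ContDiffOn ℝ ∞ X U)
    (h : IsInfinitesimalPointSymmetry flatF flatH U X) :
    IsFlatKilling U (comp X 0) (comp X 1) (comp X 2) := by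
  rw [isInfinitesimalPointSymmetry_flat_iff] at h
  have hc := contDiffOn_comp hX
  have A3 : ∀ q ∈ U, pd 3 (comp X 0) q = 0 := fun q hq => by
    have := ((h q hq).2.2 (Pi.single 3 1) (by simp [omega1_apply]) (by simp) (by simp)).1
    rw [fderiv_comp hX hq] at this
    simpa [Fin.sum_univ_succ, Pi.single_apply] using this
  have A4 : ∀ q ∈ U, pd 4 (comp X 0) q = 0 := fun q hq => by
    have := ((h q hq).2.2 (Pi.single 4 1) (by simp [omega1_apply]) (by simp) (by simp)).1
    rw [fderiv_comp hX hq] at this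
    simpa [Pi.single_apply] using this
  have B3 : ∀ q ∈ U, pd 3 (comp X 1) q = 0 := fun q hq => by
    have := ((h q hq).2.2 (Pi.single 3 1) (by simp [omega1_apply]) (by simp) (by simp)).2
    rw [fderiv_comp hX hq] at this
    simpa [Pi.single_apply] using this
  have B4 : ∀ q ∈ U, pd 4 (comp X 1) q = 0 := fun q hq => by
    have := ((h q hq).2.2 (Pi.single 4 1) (by simp [omega1_apply]) (by simp) (by simp)).2
    rw [fderiv_comp hX hq] at this
    simpa [Pi.single_apply] using this
  have C3 : ∀ q ∈ U, pd 3 (comp X 2) q = 0 := fun q hq => by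
    have := (h q hq).1 (Pi.single 3 1) (by simp [omega1_apply])
    rw [lieDerivative_omega1, fderiv_comp hX hq, fderiv_comp hX hq, fderiv_comp hX hq] at this
    simpa [Pi.single_apply, A3 q hq, B3 q hq] using this
  have C4 : ∀ q ∈ U, pd 4 (comp X 2) q = 0 := fun q hq => by
    have := (h q hq).1 (Pi.single 4 1) (by simp [omega1_apply])
    rw [lieDerivative_omega1, fderiv_comp hX hq, fderiv_comp hX hq, fderiv_comp hX hq] at this
    simpa [Pi.single_apply, A4 q hq, B4 q hq] using this
  -- `f k` is the coefficient of p^k in (L_X g)(v,v) for the null vector v = (-p/2, 1, -p²/4).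
  let f : ℕ → Jet → ℝ := fun k => match k with
    | 0 => pd 1 (comp X 2)
    | 1 => fun q => -pd 1 (comp X 0) q - (1 / 2) * pd 0 (comp X 2) q
    | 2 => fun q => (1 / 2) * pd 0 (comp X 0) q - (1 / 4) * pd 2 (comp X 2) q
        - (1 / 4) * pd 1 (comp X 1) q
    | 3 => fun q => (1 / 4) * pd 2 (comp X 0) q + (1 / 8) * pd 0 (comp X 1) q
    | 4 => fun q => (1 / 16) * pd 2 (comp X 1) q
    | _ + 5 => fun _ => 0
  have hs : ∀ i j, ContDiffOn ℝ ∞ (pd i (comp X j)) U := fun i j => contDiffOn_pd (hc j) i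
  have hf : ∀ k, ContDiffOn ℝ ∞ (f k) U := by
    rintro (_ | _ | _ | _ | _ | k)
    · exact hs 1 2
    · exact (hs 1 0).neg.sub (contDiffOn_const.mul (hs 0 2))
    · exact ((contDiffOn_const.mul (hs 0 0)).sub (contDiffOn_const.mul (hs 2 2))).sub
        (contDiffOn_const.mul (hs 1 1))
    · exact (contDiffOn_const.mul (hs 2 0)).add (contDiffOn_const.mul (hs 0 1))
    · exact contDiffOn_const.mul (hs 2 1)
    · exact contDiffOn_const
  -- Since A, B, C do not depend on p, neither do their partial derivatives, as mixed partials
  -- commute.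
  have h3 : ∀ q ∈ U, ∀ i, ∀ j : Fin 5, j = 0 ∨ j = 1 ∨ j = 2 →
      fderiv ℝ (pd i (comp X j)) q (Pi.single 3 1) = 0 := by
    intro q hq i j hj
    refine pd_pd_eq_zero (hc j) (i := 3) (fun q hq => ?_) i q hq
    rcases hj with rfl | rfl | rfl
    exacts [A3 q hq, B3 q hq, C3 q hq]
  have hfp : ∀ k, ∀ q ∈ U, pd 3 (f k) q = 0 := by
    intro k q hq
    have d : ∀ i j, HasFDerivAt (pd i (comp X j)) _ q := fun i j =>
      (differentiableAt_of_contDiffOn (hs i j) hq).hasFDerivAt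
    obtain _ | _ | _ | _ | _ | k := k
    · exact h3 q hq 1 2 (by simp)
    · have e : HasFDerivAt (f 1) _ q := (d 1 0).neg.sub ((d 0 2).const_mul (1 / 2))
      rw [pd, e.fderiv]
      simp [h3 q hq]
    · have e : HasFDerivAt (f 2) _ q := (((d 0 0).const_mul (1 / 2)).sub
        ((d 2 2).const_mul (1 / 4))).sub ((d 1 1).const_mul (1 / 4))
      rw [pd, e.fderiv]
      simp [h3 q hq]
    · have e : HasFDerivAt (f 3) _ q :=
        ((d 2 0).const_mul (1 / 4)).add ((d 0 1).const_mul (1 / 8))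
      rw [pd, e.fderiv]
      simp [h3 q hq]
    · have e : HasFDerivAt (f 4) _ q := (d 2 1).const_mul (1 / 16)
      rw [pd, e.fderiv]
      simp [h3 q hq]
    · exact pd_eq_zero (fun _ _ => rfl) 3 hq
  -- The two test vectors span the kernel of ω¹ modulo ∂_p and ∂_r. Subtracting p/2 times the first
  -- from the second gives the null vector and cancels the unknown p-component of X.
  have hsum : ∀ q ∈ U, ∑ k ∈ Finset.range 5, q 3 ^ k * f k q = 0 := by
    intro q hq
    have e1 := (h q hq).1 ![1, 0, q 3, 0, 0] (by simp [omega1_apply])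
    have e2 := (h q hq).1 ![0, 1, (1 / 4) * q 3 ^ 2, 0, 0] (by simp [omega1_apply])
    rw [lieDerivative_omega1, fderiv_comp hX hq, fderiv_comp hX hq, fderiv_comp hX hq] at e1 e2
    simp [Fin.sum_univ_succ] at e1 e2
    simp only [Finset.sum_range_succ, Finset.sum_range_zero, f]
    linear_combination e2 - (1 / 2) * q 3 * e1
  have key := eq_zero_of_sum_pow_mul_eq_zero 3 5 f hf hfp hsum
  refine ⟨A3, A4, B3, B4, C3, C4, fun q hq => ?_, fun q hq => ?_, fun q hq => ?_, fun q hq => ?_,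
    fun q hq => ?_⟩
  · have := key 4 (by norm_num) q hq
    simp only [f] at this
    linarith
  · exact key 0 (by norm_num) q hq
  · have := key 2 (by norm_num) q hq
    simp only [f] at this
    linarith
  · have := key 1 (by norm_num) q hq
    simp only [f] at this
    linarith
  · have := key 3 (by norm_num) q hq
    simp only [f] at this
    linarith

theorem forall_pd_eq_zero {f : Jet → ℝ} (h0 : ∀ q ∈ U, pd 0 f q = 0) (h1 : ∀ q ∈ U, pd 1 f q = 0)
    (h2 : ∀ q ∈ U, pd 2 f q = 0) (h3 : ∀ q ∈ U, pd 3 f q = 0) (h4 : ∀ q ∈ U, pd 4 f q = 0) :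
    ∀ i, ∀ q ∈ U, pd i f q = 0 := fun i => by
  fin_cases i <;> assumption

/-- Differentiating the equations expresses the second derivatives of C through those of B and
forces the latter to be locally constant. Connectedness then propagates zero from the base point to
the second derivatives, the first derivatives and finally the functions. -/
theorem IsFlatKilling.eq_zero (hU : IsPreconnected (U : Set Jet)) {A B C : Jet → ℝ}
    (h : IsFlatKilling U A B C) (hA : ContDiffOn ℝ ∞ A U) (hB : ContDiffOn ℝ ∞ B U)
    (hC : ContDiffOn ℝ ∞ C U) {q₀ : Jet} (hq₀ : q₀ ∈ U) (A₀ : A q₀ = 0) (B₀ : B q₀ = 0)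
    (C₀ : C q₀ = 0) (Bx₀ : pd 0 B q₀ = 0) (By₀ : pd 1 B q₀ = 0) (Cx₀ : pd 0 C q₀ = 0)
    (Cz₀ : pd 2 C q₀ = 0) (Bxy₀ : pd 1 (pd 0 B) q₀ = 0) (Byy₀ : pd 1 (pd 1 B) q₀ = 0)
    (Bxx₀ : pd 0 (pd 0 B) q₀ = 0) :
    ∀ q ∈ U, A q = 0 ∧ B q = 0 ∧ C q = 0 := by
  have hpA := contDiffOn_pd hA
  have hpB := contDiffOn_pd hB
  have hpC := contDiffOn_pd hC
  have cA := fun i j q hq => pd_comm (q := q) hA i j hq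
  have cB := fun i j q hq => pd_comm (q := q) hB i j hq
  have cC := fun i j q hq => pd_comm (q := q) hC i j hq
  -- The zero third terms of `eq_y` and `eq_z` let the three-term `pd_linear` serve all three
  -- equations.
  have dx := pd_linear (hpA 0) (hpC 2) (hpB 1) h.eq_x
  have dy := pd_linear (hpA 1) (hpC 0) (hpC 0) h.eq_y
  have dz := pd_linear (hpA 2) (hpB 0) (hpB 0) h.eq_z
  have zB := pd_pd_eq_zero hB h.B_z
  have yC := pd_pd_eq_zero hC h.C_y
  -- the second derivatives of `C` are those of `B`
  have exz : ∀ q ∈ U, pd 2 (pd 0 C) q = pd 1 (pd 0 B) q := fun q hq => by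
    linarith [dy 2 q hq, dz 1 q hq, cA 1 2 q hq]
  have exx : ∀ q ∈ U, pd 0 (pd 0 C) q = -pd 1 (pd 1 B) q := fun q hq => by
    linarith [dy 0 q hq, dx 1 q hq, cA 1 0 q hq, yC 2 q hq]
  have ezz : ∀ q ∈ U, pd 2 (pd 2 C) q = -pd 0 (pd 0 B) q := fun q hq => by
    linarith [dx 2 q hq, dz 0 q hq, cA 2 0 q hq, zB 1 q hq]
  have neg : ∀ {f g : Jet → ℝ}, (∀ q ∈ U, f q = -g q) → ∀ i, ∀ q ∈ U, pd i f q = -pd i g q := by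
    intro f g hfg i q hq
    rw [pd_congr hfg i hq]
    simp [pd, fderiv_fun_neg]
  -- the second derivatives of `B` are constant, hence vanish
  have Exy_x : ∀ q ∈ U, pd 0 (pd 1 (pd 0 B)) q = 0 := fun q hq => by
    rw [← pd_congr exz 0 hq, pd_comm (hpC 0) 0 2 hq, neg exx 2 q hq,
      pd_pd_eq_zero (hpB 1) (zB 1) 1 q hq, neg_zero]
  -- The mixed derivative comes first: its vanishing is used to kill ∂_x B_yy, ∂_y B_xx and ∂_x
  -- B_xx.
  have Bxy : ∀ q ∈ U, pd 1 (pd 0 B) q = 0 := by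
    refine eq_zero_of_pd_eq_zero hU (contDiffOn_pd (hpB 0) 1) (forall_pd_eq_zero Exy_x ?_
      (pd_pd_eq_zero (hpB 0) (zB 0) 1) (pd_pd_eq_zero (hpB 0) (pd_pd_eq_zero hB h.B_p 0) 1)
      (pd_pd_eq_zero (hpB 0) (pd_pd_eq_zero hB h.B_r 0) 1)) hq₀ Bxy₀
    intro q hq
    rw [← pd_congr exz 1 hq, pd_pd_eq_zero (hpC 0) (yC 0) 2 q hq]
  have Bxy' : ∀ q ∈ U, pd 0 (pd 1 B) q = 0 := fun q hq => by rw [cB 0 1 q hq, Bxy q hq]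
  have Byy : ∀ q ∈ U, pd 1 (pd 1 B) q = 0 := by
    refine eq_zero_of_pd_eq_zero hU (contDiffOn_pd (hpB 1) 1)
      (forall_pd_eq_zero (pd_pd_eq_zero (hpB 1) Bxy' 1) ?_
      (pd_pd_eq_zero (hpB 1) (zB 1) 1) (pd_pd_eq_zero (hpB 1) (pd_pd_eq_zero hB h.B_p 1) 1)
      (pd_pd_eq_zero (hpB 1) (pd_pd_eq_zero hB h.B_r 1) 1)) hq₀ Byy₀
    intro q hq
    have := neg exx 1 q hq
    rw [pd_pd_eq_zero (hpC 0) (yC 0) 0 q hq] at this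
    linarith
  have Bxx : ∀ q ∈ U, pd 0 (pd 0 B) q = 0 := by
    refine eq_zero_of_pd_eq_zero hU (contDiffOn_pd (hpB 0) 0)
      (forall_pd_eq_zero ?_ (pd_pd_eq_zero (hpB 0) Bxy 0)
      (pd_pd_eq_zero (hpB 0) (zB 0) 0) (pd_pd_eq_zero (hpB 0) (pd_pd_eq_zero hB h.B_p 0) 0)
      (pd_pd_eq_zero (hpB 0) (pd_pd_eq_zero hB h.B_r 0) 0)) hq₀ Bxx₀
    intro q hq
    have h1 := neg ezz 0 q hq
    have h2 : ∀ q ∈ U, pd 2 (pd 0 C) q = 0 := fun q hq => by rw [exz q hq, Bxy q hq]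
    have h3 : ∀ q ∈ U, pd 0 (pd 2 C) q = 0 := fun q hq => by rw [cC 0 2 q hq, h2 q hq]
    rw [pd_pd_eq_zero (hpC 2) h3 2 q hq] at h1
    linarith
  have Cxz : ∀ q ∈ U, pd 2 (pd 0 C) q = 0 := fun q hq => by rw [exz q hq, Bxy q hq]
  have Cxz' : ∀ q ∈ U, pd 0 (pd 2 C) q = 0 := fun q hq => by rw [cC 0 2 q hq, Cxz q hq]
  have Cxx : ∀ q ∈ U, pd 0 (pd 0 C) q = 0 := fun q hq => by rw [exx q hq, Byy q hq, neg_zero]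
  have Czz : ∀ q ∈ U, pd 2 (pd 2 C) q = 0 := fun q hq => by rw [ezz q hq, Bxx q hq, neg_zero]
  have Bx := eq_zero_of_pd_eq_zero hU (hpB 0) (forall_pd_eq_zero Bxx Bxy (zB 0)
    (pd_pd_eq_zero hB h.B_p 0) (pd_pd_eq_zero hB h.B_r 0)) hq₀ Bx₀
  have By := eq_zero_of_pd_eq_zero hU (hpB 1) (forall_pd_eq_zero Bxy' Byy (zB 1)
    (pd_pd_eq_zero hB h.B_p 1) (pd_pd_eq_zero hB h.B_r 1)) hq₀ By₀
  have Cx := eq_zero_of_pd_eq_zero hU (hpC 0) (forall_pd_eq_zero Cxx (yC 0) Cxz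
    (pd_pd_eq_zero hC h.C_p 0) (pd_pd_eq_zero hC h.C_r 0)) hq₀ Cx₀
  have Cz := eq_zero_of_pd_eq_zero hU (hpC 2) (forall_pd_eq_zero Cxz' (yC 2) Czz
    (pd_pd_eq_zero hC h.C_p 2) (pd_pd_eq_zero hC h.C_r 2)) hq₀ Cz₀
  have hB0 := eq_zero_of_pd_eq_zero hU hB (forall_pd_eq_zero Bx By h.B_z h.B_p h.B_r) hq₀ B₀
  have hC0 := eq_zero_of_pd_eq_zero hU hC (forall_pd_eq_zero Cx h.C_y Cz h.C_p h.C_r) hq₀ C₀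
  have hA0 := eq_zero_of_pd_eq_zero hU hA (forall_pd_eq_zero
    (fun q hq => by linarith [h.eq_x q hq, Cz q hq, By q hq])
    (fun q hq => by linarith [h.eq_y q hq, Cx q hq])
    (fun q hq => by linarith [h.eq_z q hq, Bx q hq]) h.A_p h.A_r) hq₀ A₀
  exact fun q hq => ⟨hA0 q hq, hB0 q hq, hC0 q hq⟩

/-- The remaining components are prolongations: the ω¹ condition on ∂_x + p∂_z determines the
p-component, and the ω² condition on ∂_x + p∂_z + r∂_p then determines the r-component. -/
theorem IsInfinitesimalPointSymmetry.eq_zero_of_comp_eq_zero {X : Jet → Jet}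
    (hX : ContDiffOn ℝ ∞ X U) (h : IsInfinitesimalPointSymmetry flatF flatH U X)
    (h0 : ∀ q ∈ U, comp X 0 q = 0 ∧ comp X 1 q = 0 ∧ comp X 2 q = 0) : ∀ q ∈ U, X q = 0 := by
  rw [isInfinitesimalPointSymmetry_flat_iff] at h
  have d0 := fun i q hq => pd_eq_zero (q := q) (fun q hq => (h0 q hq).1) i hq
  have d1 := fun i q hq => pd_eq_zero (q := q) (fun q hq => (h0 q hq).2.1) i hq
  have d2 := fun i q hq => pd_eq_zero (q := q) (fun q hq => (h0 q hq).2.2) i hq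
  have h3 : ∀ q ∈ U, comp X 3 q = 0 := fun q hq => by
    have e := (h q hq).1 ![1, 0, q 3, 0, 0] (by simp [omega1_apply])
    rw [lieDerivative_omega1, fderiv_comp hX hq, fderiv_comp hX hq, fderiv_comp hX hq] at e
    change X q 3 = 0
    simpa [d0 _ q hq, d1 _ q hq, d2 _ q hq] using e
  have d3 := fun i q hq => pd_eq_zero (q := q) h3 i hq
  have h4 : ∀ q ∈ U, comp X 4 q = 0 := fun q hq => by
    have e := ((h q hq).2.1 ![1, 0, q 3, q 4, 0] (by simp [omega1_apply])
      (by simp [omega2_apply]) (by simp [omega3_apply])).1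
    rw [lieDerivative_omega2, fderiv_comp hX hq, fderiv_comp hX hq, fderiv_comp hX hq] at e
    change X q 4 = 0
    simpa [d0 _ q hq, d1 _ q hq, d3 _ q hq] using e
  intro q hq
  ext i
  fin_cases i
  exacts [(h0 q hq).1, (h0 q hq).2.1, (h0 q hq).2.2, h3 q hq, h4 q hq]

end Determination

/-! ### Transport of the algebraic structure from coefficient vectors -/

theorem isSimple_of_flatBracket {L : Type*} [LieRing L] [LieAlgebra ℝ L]
    (e : (Fin 10 → ℝ) ≃ₗ[ℝ] L) (he : ∀ c d, ⁅e c, e d⁆ = e (flatBracket c d)) :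
    LieAlgebra.IsSimple ℝ L where
  eq_bot_or_eq_top I := by
    have h := eq_bot_or_eq_top_of_flatBracket_mem (I.toSubmodule.comap e.toLinearMap)
      fun c d hd => by
        have h1 : ⁅e c, e d⁆ ∈ I := lie_mem_right ℝ L I _ _ hd
        rwa [he] at h1
    refine h.imp (fun h => ?_) fun h => ?_
    · rw [LieSubmodule.eq_bot_iff]
      intro x hx
      have h1 : e.symm x ∈ I.toSubmodule.comap e.toLinearMap := by simpa using hx
      rw [h, Submodule.mem_bot] at h1
      simpa using h1
    · rw [eq_top_iff]
      intro x _
      have h1 : e.symm x ∈ I.toSubmodule.comap e.toLinearMap := h ▸ Submodule.mem_top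
      simpa using h1
  non_abelian h := by
    have h1 := he (gen 2) (gen 8)
    rw [h.trivial, eq_comm, map_eq_zero_iff e e.injective] at h1
    have h2 := congr_fun h1 6
    simp [flatBracket] at h2

theorem flatTable_of_flatBracket {L : Type*} [LieRing L] [LieAlgebra ℝ L]
    (e : (Fin 10 → ℝ) ≃ₗ[ℝ] L) (he : ∀ c d, ⁅e c, e d⁆ = e (flatBracket c d))
    {i j : Fin 10} (hij : i ≤ j) :
    ⁅e (gen i), e (gen j)⁆ = flatTable (e (gen 0)) (e (gen 1)) (e (gen 2)) (e (gen 3)) (e (gen 4))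
      (e (gen 5)) (e (gen 6)) (e (gen 7)) (e (gen 8)) (e (gen 9)) i j := by
  rw [he, ← flatTable_gen hij]
  exact map_flatTable e.toLinearMap gen i j

theorem nonempty_lieEquiv_so' {L : Type*} [LieRing L] [LieAlgebra ℝ L]
    (e : (Fin 10 → ℝ) ≃ₗ[ℝ] L) (he : ∀ c d, ⁅e c, e d⁆ = e (flatBracket c d)) :
    Nonempty (L ≃ₗ⁅ℝ⁆ LieAlgebra.Orthogonal.so' (Fin 3) (Fin 2) ℝ) := by
  let f := LinearEquiv.ofBijective soLinear soLinear_bijective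
  refine ⟨{ e.symm.trans f with map_lie' := ?_ }⟩
  intro x y
  change soLinear (e.symm ⁅x, y⁆) = ⁅soLinear (e.symm x), soLinear (e.symm y)⁆
  rw [soLinear_bracket]
  congr 1
  rw [LinearEquiv.symm_apply_eq, ← he, e.apply_symm_apply, e.apply_symm_apply]

/-! ### The symmetry algebra on a connected open set -/

section FlatSymmetries

variable {U : Opens Jet}

theorem IsInfinitesimalPointSymmetry.congr {F H : Jet → ℝ} {X Y : Jet → Jet}
    (hX : IsInfinitesimalPointSymmetry F H U X) (hXY : ∀ q ∈ U, X q = Y q) :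
    IsInfinitesimalPointSymmetry F H U Y := by
  intro q hq
  have e : X =ᶠ[nhds q] Y := by
    filter_upwards [U.isOpen.mem_nhds hq] with q' hq' using hXY q' hq'
  have h : ∀ α, lieDerivative X α q = lieDerivative Y α q := fun α => by
    rw [lieDerivative, lieDerivative, hXY q hq, e.fderiv_eq]
  simpa only [h] using hX q hq

/-- The vector field on `U` with coefficient vector `c`. -/
def flatOn (U : Opens Jet) : (Fin 10 → ℝ) →ₗ[ℝ] smoothFields U where
  toFun c := ⟨(U : Set Jet).indicator (flatCombo c),
    (contDiff_flatCombo c).contDiffOn.congr fun _ hq => Set.indicator_of_mem hq _,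
    fun _ hq => Set.indicator_of_notMem hq _⟩
  map_add' c d := Subtype.ext <| by
    simp only [flatCombo_add, Submodule.coe_add]
    exact Set.indicator_add _ _ _
  map_smul' a c := Subtype.ext <| by
    simp only [flatCombo_smul, Submodule.coe_smul]
    exact Set.indicator_const_smul (U : Set Jet) a (flatCombo c)

theorem flatOn_apply (c : Fin 10 → ℝ) {q : Jet} (hq : q ∈ U) :
    (flatOn U c : Jet → Jet) q = flatCombo c q :=
  Set.indicator_of_mem hq _

theorem flatOn_bracket (c d : Fin 10 → ℝ) :
    ⁅flatOn U c, flatOn U d⁆ = flatOn U (flatBracket c d) := by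
  refine smoothFields.ext fun q hq => ?_
  have e : ∀ c, (flatOn U c : Jet → Jet) =ᶠ[nhds q] flatCombo c := fun c => by
    filter_upwards [U.isOpen.mem_nhds hq] with q' hq' using flatOn_apply c hq'
  rw [smoothFields.bracket_apply _ _ hq, (e c).lieBracket_vectorField_eq (e d),
    lieBracket_flatCombo, flatOn_apply _ hq]

/-- The kernel is an ideal, and ∂_x is nonzero at any point of `U`. -/
theorem flatOn_injective (hU : (U : Set Jet).Nonempty) : Function.Injective (flatOn U) := by
  rw [← LinearMap.ker_eq_bot]
  refine (eq_bot_or_eq_top_of_flatBracket_mem _ fun c d hd => ?_).resolve_right fun h => ?_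
  · rw [LinearMap.mem_ker] at hd ⊢
    rw [← flatOn_bracket, hd, lie_zero]
  · obtain ⟨q, hq⟩ := hU
    have h6 : gen 6 ∈ LinearMap.ker (flatOn U) := h ▸ Submodule.mem_top
    have h1 := flatOn_apply (gen 6) hq
    rw [LinearMap.mem_ker.1 h6] at h1
    simpa [flatCombo] using congr_fun h1 0

theorem flatOn_isInfinitesimalPointSymmetry (c : Fin 10 → ℝ) :
    IsInfinitesimalPointSymmetry flatF flatH U (flatOn U c : Jet → Jet) :=
  (flatCombo_isInfinitesimalPointSymmetry U c).congr fun _ hq => (flatOn_apply c hq).symm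

theorem lieDerivative_add {X Y : Jet → Jet} (α : OneForm) {q : Jet} (hX : DifferentiableAt ℝ X q)
    (hY : DifferentiableAt ℝ Y q) :
    lieDerivative (X + Y) α q = lieDerivative X α q + lieDerivative Y α q := by
  ext v
  simp [lieDerivative, fderiv_add hX hY]
  ring

theorem lieDerivative_const_smul {X : Jet → Jet} (a : ℝ) (α : OneForm) {q : Jet}
    (hX : DifferentiableAt ℝ X q) : lieDerivative (a • X) α q = a • lieDerivative X α q := by
  ext v
  simp [lieDerivative, fderiv_const_smul hX]

/-- The infinitesimal point symmetries of the flat model on `U`. -/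
def flatSymmetries (U : Opens Jet) : Submodule ℝ (smoothFields U) where
  carrier := {X | IsInfinitesimalPointSymmetry flatF flatH U (X : Jet → Jet)}
  add_mem' := by
    intro X Y hX hY
    rw [Set.mem_ofPred_eq, isInfinitesimalPointSymmetry_flat_iff] at hX hY ⊢
    intro q hq
    have dX := smoothFields.differentiableAt X hq
    have dY := smoothFields.differentiableAt Y hq
    obtain ⟨x1, x2, x3⟩ := hX q hq
    obtain ⟨y1, y2, y3⟩ := hY q hq
    simp only [Submodule.coe_add, lieDerivative_add _ dX dY, fderiv_add dX dY, add_apply,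
      Pi.add_apply]
    refine ⟨fun v a => ?_, fun v a b c => ?_, fun v a b c => ?_⟩
    · simp [x1 v a, y1 v a]
    · simp [x2 v a b c, y2 v a b c]
    · simp [x3 v a b c, y3 v a b c]
  zero_mem' := by
    have h := flatOn_isInfinitesimalPointSymmetry (U := U) 0
    rwa [map_zero] at h
  smul_mem' := by
    intro t X hX
    rw [Set.mem_ofPred_eq, isInfinitesimalPointSymmetry_flat_iff] at hX ⊢
    intro q hq
    have dX := smoothFields.differentiableAt X hq
    obtain ⟨x1, x2, x3⟩ := hX q hq
    simp only [Submodule.coe_smul, lieDerivative_const_smul _ _ dX, fderiv_const_smul dX,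
      smul_apply, Pi.smul_apply]
    refine ⟨fun v a => ?_, fun v a b c => ?_, fun v a b c => ?_⟩
    · simp [x1 v a]
    · simp [x2 v a b c]
    · simp [x3 v a b c]

/-- The value of the `i`-th component of a vector field at a point of `U`. -/
def evalComp (q : Jet) (i : Fin 5) : smoothFields U →ₗ[ℝ] ℝ where
  toFun X := comp X i q
  map_add' _ _ := rfl
  map_smul' _ _ := rfl

theorem pd_comp_add (X Y : smoothFields U) (i j : Fin 5) {q : Jet} (hq : q ∈ U) :
    pd j (comp (X + Y : smoothFields U) i) q = pd j (comp X i) q + pd j (comp Y i) q := by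
  have hX := differentiableAt_of_contDiffOn (contDiffOn_comp X.2.1 i) hq
  have hY := differentiableAt_of_contDiffOn (contDiffOn_comp Y.2.1 i) hq
  exact congr_arg (fun f => f (Pi.single j 1)) (fderiv_add hX hY)

theorem pd_comp_smul (a : ℝ) (X : smoothFields U) (i j : Fin 5) {q : Jet} (hq : q ∈ U) :
    pd j (comp (a • X : smoothFields U) i) q = a * pd j (comp X i) q := by
  have hX := differentiableAt_of_contDiffOn (contDiffOn_comp X.2.1 i) hq
  exact congr_arg (fun f => f (Pi.single j 1)) (fderiv_const_smul hX a)

/-- A first partial derivative of the `i`-th component of a vector field at a point of `U`. -/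
def pdComp {q : Jet} (hq : q ∈ U) (j i : Fin 5) : smoothFields U →ₗ[ℝ] ℝ where
  toFun X := pd j (comp X i) q
  map_add' X Y := pd_comp_add X Y i j hq
  map_smul' a X := pd_comp_smul a X i j hq

/-- A second partial derivative of the `i`-th component of a vector field at a point of `U`. -/
def pdPdComp {q : Jet} (hq : q ∈ U) (k j i : Fin 5) : smoothFields U →ₗ[ℝ] ℝ where
  toFun X := pd k (pd j (comp X i)) q
  map_add' X Y := by
    rw [pd_congr (fun q hq => pd_comp_add X Y i j hq) k hq]
    have hX := differentiableAt_of_contDiffOn (contDiffOn_pd (contDiffOn_comp X.2.1 i) j) hq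
    have hY := differentiableAt_of_contDiffOn (contDiffOn_pd (contDiffOn_comp Y.2.1 i) j) hq
    exact congr_arg (fun f => f (Pi.single k 1)) (fderiv_add hX hY)
  map_smul' a X := by
    rw [pd_congr (fun q hq => pd_comp_smul a X i j hq) k hq]
    have hX := differentiableAt_of_contDiffOn (contDiffOn_pd (contDiffOn_comp X.2.1 i) j) hq
    exact congr_arg (fun f => f (Pi.single k 1)) (fderiv_const_smul hX a)

/-- The part of the second jet at a point that determines an infinitesimal point symmetry. -/
def symmetryJet {q : Jet} (hq : q ∈ U) : smoothFields U →ₗ[ℝ] (Fin 10 → ℝ) :=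
  LinearMap.pi ![evalComp q 0, evalComp q 1, evalComp q 2, pdComp hq 0 1, pdComp hq 1 1,
    pdComp hq 0 2, pdComp hq 2 2, pdPdComp hq 1 0 1, pdPdComp hq 1 1 1, pdPdComp hq 0 0 1]

theorem eq_zero_of_symmetryJet_eq_zero (hU : IsPreconnected (U : Set Jet)) {q : Jet} (hq : q ∈ U)
    {X : smoothFields U} (hX : X ∈ flatSymmetries U) (h : symmetryJet hq X = 0) : X = 0 := by
  have hc := contDiffOn_comp X.2.1
  refine smoothFields.ext fun q' hq' => ?_
  exact IsInfinitesimalPointSymmetry.eq_zero_of_comp_eq_zero X.2.1 hX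
    ((IsInfinitesimalPointSymmetry.isFlatKilling X.2.1 hX).eq_zero hU (hc 0) (hc 1) (hc 2) hq
      (congr_fun h 0) (congr_fun h 1) (congr_fun h 2) (congr_fun h 3) (congr_fun h 4)
      (congr_fun h 5) (congr_fun h 6) (congr_fun h 7) (congr_fun h 8) (congr_fun h 9)) q' hq'

/-- By rigidity `symmetryJet` is injective on symmetries, so its composite with `flatOn U` is an
injective endomorphism of ℝ¹⁰, hence surjective. Some combination of the ten fields therefore has
the same jet as X, and their difference, a symmetry with zero jet, vanishes. -/
theorem mem_flatSymmetries_iff (hU : IsConnected (U : Set Jet)) (X : smoothFields U) :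
    X ∈ flatSymmetries U ↔ ∃ c, flatOn U c = X := by
  constructor
  · intro hX
    obtain ⟨q, hq⟩ := hU.nonempty
    have hinj : Function.Injective (symmetryJet hq ∘ₗ flatOn U) := by
      rw [← LinearMap.ker_eq_bot, LinearMap.ker_eq_bot']
      intro c hc
      have h := eq_zero_of_symmetryJet_eq_zero hU.isPreconnected hq
        (flatOn_isInfinitesimalPointSymmetry c) hc
      exact (map_eq_zero_iff _ (flatOn_injective hU.nonempty)).1 h
    obtain ⟨c, hc⟩ := LinearMap.surjective_of_injective hinj (symmetryJet hq X)
    refine ⟨c, sub_eq_zero.1 (eq_zero_of_symmetryJet_eq_zero hU.isPreconnected hq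
      (sub_mem (flatOn_isInfinitesimalPointSymmetry c) hX) ?_)⟩
    rw [map_sub, sub_eq_zero]
    exact hc
  · rintro ⟨c, rfl⟩
    exact flatOn_isInfinitesimalPointSymmetry c

/-- The Lie algebra of infinitesimal point symmetries of the flat model on `U`. -/
def flatSymmetryAlgebra (hU : IsConnected (U : Set Jet)) : LieSubalgebra ℝ (smoothFields U) where
  toSubmodule := flatSymmetries U
  lie_mem' := by
    -- Closure under the bracket follows from the parametrization and `flatOn_bracket`, with no
    -- computation of Lie derivatives along a bracket.
    intro X Y hX hY
    obtain ⟨c, rfl⟩ := (mem_flatSymmetries_iff hU X).1 hX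
    obtain ⟨d, rfl⟩ := (mem_flatSymmetries_iff hU Y).1 hY
    exact (mem_flatSymmetries_iff hU _).2 ⟨_, (flatOn_bracket c d).symm⟩

/-- The infinitesimal point symmetries are parametrized by their coefficient vectors. -/
def flatSymmetryEquiv (hU : IsConnected (U : Set Jet)) :
    (Fin 10 → ℝ) ≃ₗ[ℝ] flatSymmetryAlgebra hU :=
  LinearEquiv.ofBijective
    ((flatOn U).codRestrict (flatSymmetries U) flatOn_isInfinitesimalPointSymmetry) <| by
    constructor
    · intro c d hcd
      exact flatOn_injective hU.nonempty (congr_arg Subtype.val hcd)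
    · rintro ⟨X, hX⟩
      obtain ⟨c, hc⟩ := (mem_flatSymmetries_iff hU X).1 hX
      exact ⟨c, Subtype.ext hc⟩

theorem coe_flatSymmetryEquiv (hU : IsConnected (U : Set Jet)) (c : Fin 10 → ℝ) :
    (flatSymmetryEquiv hU c : smoothFields U) = flatOn U c :=
  rfl

theorem flatSymmetryEquiv_bracket (hU : IsConnected (U : Set Jet)) (c d : Fin 10 → ℝ) :
    ⁅flatSymmetryEquiv hU c, flatSymmetryEquiv hU d⁆ = flatSymmetryEquiv hU (flatBracket c d) :=
  Subtype.ext (flatOn_bracket c d)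

end FlatSymmetries

end ParaCR
end

theorem mainTheorem10 (U : TopologicalSpace.Opens ParaCR.Jet)
    (hU : IsConnected (U : Set ParaCR.Jet)) :
    ∃ 𝔤 : LieSubalgebra ℝ (ParaCR.smoothFields U),
      (∀ X : ParaCR.smoothFields U,
        X ∈ 𝔤 ↔ ParaCR.IsInfinitesimalPointSymmetry ParaCR.flatF ParaCR.flatH U
          (X : ParaCR.Jet → ParaCR.Jet)) ∧
      LieAlgebra.IsSimple ℝ 𝔤 ∧
      Nonempty (𝔤 ≃ₗ⁅ℝ⁆ LieAlgebra.Orthogonal.so' (Fin 3) (Fin 2) ℝ) ∧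
      ∃ b : Module.Basis (Fin 10) ℝ 𝔤,
        (∀ i : Fin 10, ∀ q ∈ U,
          ((b i : ParaCR.smoothFields U) : ParaCR.Jet → ParaCR.Jet) q = ParaCR.flatField i q) ∧
        ∀ i j : Fin 10, i ≤ j →
          ⁅b i, b j⁆ =
            ParaCR.flatTable (b 0) (b 1) (b 2) (b 3) (b 4) (b 5) (b 6) (b 7) (b 8) (b 9) i j := by
  have he := ParaCR.flatSymmetryEquiv_bracket hU
  refine ⟨ParaCR.flatSymmetryAlgebra hU, fun X => Iff.rfl,
    ParaCR.isSimple_of_flatBracket _ he, ParaCR.nonempty_lieEquiv_so' _ he,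
    Module.Basis.ofEquivFun (ParaCR.flatSymmetryEquiv hU).symm, fun i q hq => ?_,
    fun i j hij => ?_⟩
  · rw [Module.Basis.coe_ofEquivFun, LinearEquiv.symm_symm, ParaCR.coe_flatSymmetryEquiv,
      ParaCR.flatOn_apply _ hq]
    exact congr_fun (ParaCR.flatCombo_gen i) q
  · simp only [Module.Basis.coe_ofEquivFun, LinearEquiv.symm_symm]
    exact ParaCR.flatTable_of_flatBracket _ he hij
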